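/- **Proposition (Construction of SSEP).** Let $S$ be a countable set, let $\mathcal E_S$ be the set of unordered pairs $\{x,y\}$ with $x\neq y$ in $S$, and let $c_{x,y}=c_{y,x}\in[0,\infty)$ for $\{x,y\}\in\mathcal E_S$, with $c_{x,x}:=0$. Assume (Assumption SSEP) that (C1) $c_x:=\sum_{y\in S}c_{x,y}<\infty$ for all $x\in S$, and (C2) for every $x\in S$ the continuous-time random walk on $S$ started at $x$ (it waits at $z$ an exponential time of mean $1/c_z\in(0,\infty]$ and then jumps to $y$ with probability $c_{z,y}/c_z$) a.s. does not explode, i.e. the sum of its successive waiting times is a.s. infinite. For a space $W$ let $D(\mathbb R_+,W)$ be the set of càdlàg paths $\eta:\mathbb R_+=[0,\infty)\to W$, with the $\sigma$-algebra generated by the coordinate maps $\eta\mapsto\eta_t$, $t\ge 0$ (for $W=\mathbb N$ and $W=\{0,1\}^S$ this is also the Borel $\sigma$-algebra of the Skorohod topology). Let $(N_{x,y})_{\{x,y\}\in\mathcal E_S}$ be independent Poisson processes with intensities $c_{x,y}$, and let $\mathbb P$ be their joint law on $D(\mathbb R_+,\mathbb N)^{\mathcal E_S}$. Let $\Gamma$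 be the set of $\mathcal K=(\mathcal K_{x,y})\in D(\mathbb R_+,\mathbb N)^{\mathcal E_S}$ such that: for every $x$, $\mathcal K_x(t):=\sum_{y\ne x}\mathcal K_{x,y}(t)$ is finite for all $t$ and $\mathcal K_x$ is càdlàg with jumps of value $+1$; every $\mathcal K_{x,y}$ has only jumps of value $+1$; and the sets of jump times of $\mathcal K_{x,y}$ and $\mathcal K_{x',y'}$ are disjoint whenever $\{x,y\}\ne\{x',y'\}$. For $\mathcal K\in\Gamma$, $x\in S$, $t\ge0$ define $X^x_t[\mathcal K]\in S\cup\{\partial\}$ by the following algorithm. Start at $x_0:=x$ with time window $[0,t]$. When at $x_k$ with a given time window, stop with output $x_k$ if no path $\mathcal K_{x_k,y}$, $y\ne x_k$, has a jump time in the window; otherwise let $t_{k+1}$ be the last such jump time, let $x_{k+1}$ be the site such that $\mathcal K_{x_k,x_{k+1}}$ jumps at $t_{k+1}$, and continue from $x_{k+1}$ with time window $[0,t_{k+1})$. If the algorithm never stops, $X^x_t[\mathcal K]:=\partial$. Let $\Gamma_*$ be the set of $\mathcal K\in\Gamma$ with $X^x_t[\mathcal K]\in S$ for all $x\in S$, $t\ge0$,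 and for $\mathcal K\in\Gamma_*$, $\sigma\in\{0,1\}^S$ put $\eta^\sigma_t[\mathcal K](x):=\sigma(X^x_t[\mathcal K])$. Then the construction is a.s. well posed: $\Gamma_*$ is measurable with $\mathbb P(\Gamma_*)=1$; for $\mathcal K\in\Gamma_*$ and all $x,t$ the algorithm has exactly one output; and, for every $\sigma$, $\eta^\sigma_\cdot[\mathcal K]\in D(\mathbb R_+,\{0,1\}^S)$ for every $\mathcal K\in\Gamma_*$, and the map $\Gamma_*\ni\mathcal K\mapsto\eta^\sigma_\cdot[\mathcal K]\in D(\mathbb R_+,\{0,1\}^S)$ is measurable. Moreover, let $\mathcal F$ be the $\sigma$-algebra above on $D(\mathbb R_+,\{0,1\}^S)$, let $\mathcal F_t$ be generated by the maps $\eta\mapsto\eta_s$, $s\in[0,t]$, and let $\mathbb P^\sigma(A):=\mathbb P(\mathcal K\in\Gamma_*:\ \eta^\sigma_\cdot[\mathcal K]\in A)$ for $A\in\mathcal F$. Then $\{\mathbb P^\sigma:\sigma\in\{0,1\}^S\}$ is a family of probability measures that forms a Markov process on $(D(\mathbb R_+,\{0,1\}^S),(\mathcal F_t)_{t\ge0},\mathcal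 F)$: (i) $\mathbb P^\sigma(\eta_0=\sigma)=1$ for all $\sigma\in\{0,1\}^S$; (ii) for every $A\in\mathcal F$ the function $\sigma\mapsto\mathbb P^\sigma(A)$ is measurable; (iii) for all $\sigma\in\{0,1\}^S$, $t\ge0$ and $A\in\mathcal F$, $\ \mathbb P^\sigma(\eta_{t+\cdot}\in A\mid\mathcal F_t)=\mathbb P^{\eta_t}(A)$ $\ \mathbb P^\sigma$-a.s. -/

import Mathlib

open Set Filter Topology MeasureTheory ProbabilityTheory
open scoped NNReal ENNReal

noncomputable section

namespace SSEP

/-! ### Càdlàg paths and the filtered path space -/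

/-- `f : ℝ₊ → W` is right-continuous and has left limits. (At time `0` the left neighbourhood is
trivial, so nothing is required there.) -/
def IsCadlag {W : Type*} [TopologicalSpace W] (f : ℝ≥0 → W) : Prop :=
  ∀ t, ContinuousWithinAt f (Ioi t) t ∧ ∃ l, Tendsto f (𝓝[<] t) (𝓝 l)

/-- The space `D(ℝ₊, W)` of càdlàg paths. As a subtype of `ℝ≥0 → W` it carries the σ-algebra
generated by the coordinate maps `η ↦ η_t`, `t ≥ 0`. -/
abbrev CadlagPath (W : Type*) [TopologicalSpace W] : Type _ :=
  {f : ℝ≥0 → W // IsCadlag f}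

theorem isCadlag_const {W : Type*} [TopologicalSpace W] (w : W) :
    IsCadlag (fun _ : ℝ≥0 => w) :=
  fun _ => ⟨continuousWithinAt_const, w, tendsto_const_nhds⟩

theorem IsCadlag.shift {W : Type*} [TopologicalSpace W] {f : ℝ≥0 → W} (hf : IsCadlag f)
    (t : ℝ≥0) : IsCadlag (fun s => f (t + s)) := by
  have hc : Continuous fun s : ℝ≥0 => t + s := by fun_prop
  intro s
  refine ⟨?_, ?_⟩
  · refine ContinuousWithinAt.comp (hf (t + s)).1 hc.continuousWithinAt ?_
    intro u hu
    exact add_lt_add_right (mem_Ioi.1 hu) t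
  · obtain ⟨l, hl⟩ := (hf (t + s)).2
    refine ⟨l, hl.comp (tendsto_nhdsWithin_iff.2 ⟨hc.continuousWithinAt, ?_⟩)⟩
    filter_upwards [self_mem_nhdsWithin] with u hu
    exact add_lt_add_right (mem_Iio.1 hu) t

/-- The shifted path `η_{t + ·}`. -/
def shiftPath {W : Type*} [TopologicalSpace W] (t : ℝ≥0) (η : CadlagPath W) : CadlagPath W :=
  ⟨fun s => η.1 (t + s), η.2.shift t⟩

/-- The canonical filtration: `ℱ_t` is generated by the coordinate maps `η ↦ η_s`, `s ∈ [0,t]`. -/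
def pathFiltration (W : Type*) [TopologicalSpace W] [MeasurableSpace W] :
    Filtration ℝ≥0 (inferInstance : MeasurableSpace (CadlagPath W)) where
  seq t := ⨆ s : Iic t, MeasurableSpace.comap (fun η : CadlagPath W => η.1 s) inferInstance
  mono' _ u htu := iSup_le fun s =>
    le_iSup (fun r : Iic u => MeasurableSpace.comap (fun η : CadlagPath W => η.1 r) inferInstance)
      ⟨s.1, le_trans s.2 htu⟩
  le' _ := iSup_le fun s =>
    Measurable.comap_le ((measurable_pi_apply (s : ℝ≥0)).comp measurable_subtype_coe)

/-- A family `(P^w)` of probability measures on the filtered path space is a Markov process. -/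
structure IsMarkovProcess {W : Type*} [TopologicalSpace W] [MeasurableSpace W]
    (P : W → Measure (CadlagPath W)) : Prop where
  isProbabilityMeasure : ∀ w, IsProbabilityMeasure (P w)
  initial : ∀ w, P w {η | η.1 0 = w} = 1
  measurable : ∀ A, MeasurableSet A → Measurable fun w => P w A
  markov : ∀ w t A, MeasurableSet A →
    (P w)⟦shiftPath t ⁻¹' A | pathFiltration W t⟧ =ᵐ[P w] fun η => (P (η.1 t)).real A

/-! ### Conductances and the random walk -/

variable {S : Type*}

/-- The unordered pairs `{x, y}` with `x ≠ y`. -/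
abbrev Edge (S : Type*) : Type _ := {e : Sym2 S // ¬ e.IsDiag}

/-- The pair `{x, y}`. -/
def edge (x y : S) (h : x ≠ y) : Edge S := ⟨s(x, y), fun hd => h (Sym2.mk_isDiag_iff.1 hd)⟩

open Classical in
/-- `c_{x,y}`, with the convention `c_{x,x} = 0`. -/
def conductance (c : Edge S → ℝ≥0) (x y : S) : ℝ≥0 := if h : x ≠ y then c (edge x y h) else 0

/-- `c_x = ∑_y c_{x,y} ∈ [0, ∞]`. -/
def rate (c : Edge S → ℝ≥0) (x : S) : ℝ≥0∞ := ∑' y, (conductance c x y : ℝ≥0∞)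

open Classical in
/-- Law of the waiting time at a site with total rate `r`: exponential of mean `1 / r`, and
infinite if `r = 0`. -/
def waitLaw (r : ℝ≥0∞) : Measure ℝ≥0∞ :=
  if r.toReal = 0 then Measure.dirac ∞ else (expMeasure r.toReal).map ENNReal.ofReal

instance (r : ℝ≥0∞) : IsProbabilityMeasure (waitLaw r) := by
  unfold waitLaw
  split_ifs with h
  · infer_instance
  · have := isProbabilityMeasure_expMeasure (lt_of_le_of_ne ENNReal.toReal_nonneg (Ne.symm h))
    exact Measure.isProbabilityMeasure_map ENNReal.measurable_ofReal.aemeasurable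

open Classical in
/-- Law of the site reached by a jump from `x`: the site `y` has probability `c_{x,y} / c_x`.
If `c_x = 0` no jump ever takes place (the waiting time is infinite) and the value is irrelevant. -/
def jumpLaw (c : Edge S → ℝ≥0) (x : S) : PMF S :=
  if h : rate c x ≠ 0 ∧ rate c x ≠ ∞ then
    PMF.normalize (fun y => (conductance c x y : ℝ≥0∞)) h.1 h.2
  else PMF.pure x

section Walk

variable [Countable S] [MeasurableSpace S] [DiscreteMeasurableSpace S]

/-- Kernel sending `x` to the law of the jump destination from `x`. -/
def jumpKernel (c : Edge S → ℝ≥0) : Kernel S S := Kernel.ofFunOfCountable fun x =>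
  (jumpLaw c x).toMeasure

instance (c : Edge S → ℝ≥0) : IsMarkovKernel (jumpKernel c) :=
  ⟨fun x => PMF.toMeasure.isProbabilityMeasure (jumpLaw c x)⟩

/-- Kernel sending `x` to the law of `(x, T)`, where `T` is the waiting time at `x`. -/
def arriveKernel (c : Edge S → ℝ≥0) : Kernel S (S × ℝ≥0∞) := Kernel.ofFunOfCountable fun x =>
  (Measure.dirac x).prod (waitLaw (rate c x))

instance (c : Edge S → ℝ≥0) : IsMarkovKernel (arriveKernel c) :=
  ⟨fun x => inferInstanceAs (IsProbabilityMeasure ((Measure.dirac x).prod (waitLaw (rate c x))))⟩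

/-- Given the first `n + 1` visited sites and waiting times, the next site is chosen by the
jump law of the last visited site, and then a waiting time at the new site is sampled. -/
def walkStep (c : Edge S → ℝ≥0) (n : ℕ) :
    Kernel (Π _ : Finset.Iic n, S × ℝ≥0∞) (S × ℝ≥0∞) :=
  (arriveKernel c ∘ₖ jumpKernel c).comap
    (fun h => (h ⟨n, Finset.mem_Iic.2 le_rfl⟩).1)
    (measurable_fst.comp (measurable_pi_apply _))

instance (c : Edge S → ℝ≥0) (n : ℕ) : IsMarkovKernel (walkStep c n) := by
  unfold walkStep; infer_instance

/-- Law of the sequence (visited sites, waiting times) of the continuous-time random walk with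
conductances `c` started at `x`. -/
def walkLaw (c : Edge S → ℝ≥0) (x : S) : Measure (ℕ → S × ℝ≥0∞) :=
  Kernel.trajMeasure (X := fun _ => S × ℝ≥0∞) (arriveKernel c x) (walkStep c)

/-- The random walk with conductances `c` is well defined for all times: the total rates are
finite, and a.s. there is no explosion, i.e. the waiting times have infinite sum. -/
structure AssumptionSSEP (c : Edge S → ℝ≥0) : Prop where
  rate_lt_top : ∀ x, rate c x < ∞
  no_explosion : ∀ x, ∀ᵐ ω ∂(walkLaw c x), ∑' n, (ω n).2 = ∞

end Walk

/-! ### Poisson processes -/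

/-- `N` is a Poisson process of intensity `r`, with càdlàg paths: it starts from `0`, is
nondecreasing, has independent increments and `N_t - N_s` is Poisson of parameter `r (t - s)`. -/
structure IsPoissonProcess {Ω : Type*} [MeasurableSpace Ω] (r : ℝ≥0) (N : Ω → CadlagPath ℕ)
    (Q : Measure Ω) : Prop where
  measurable : Measurable N
  zero : ∀ᵐ ω ∂Q, (N ω).1 0 = 0
  monotone : ∀ᵐ ω ∂Q, Monotone (N ω).1
  indep : HasIndepIncrements (fun t ω => (N ω).1 t) Q
  increment : ∀ s t : ℝ≥0, s ≤ t →
    HasLaw (fun ω => (N ω).1 t - (N ω).1 s) (poissonMeasure (r * (t - s))) Q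

/-! ### The stirring graphical construction -/

/-- `t` is a jump time of the path `f`. -/
def IsJumpTime (f : CadlagPath ℕ) (t : ℝ≥0) : Prop := ¬ ContinuousAt f.1 t

/-- All jumps of `f` have value `+1`. -/
def HasUnitJumps (f : CadlagPath ℕ) : Prop :=
  ∀ t, IsJumpTime f t → ∀ᶠ s in 𝓝[<] t, f.1 t = f.1 s + 1

open Classical in
/-- `𝒦_x(t) = ∑_{y ≠ x} 𝒦_{x,y}(t) ∈ ℕ ∪ {∞}`. -/
def siteCount (K : Edge S → CadlagPath ℕ) (x : S) (t : ℝ≥0) : ℝ≥0∞ :=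
  ∑' y, if h : x ≠ y then (((K (edge x y h)).1 t : ℕ) : ℝ≥0∞) else 0

/-- The set `Γ`: the counts `𝒦_x` are finite and càdlàg with jumps of value `+1`, the `𝒦_{x,y}`
have jumps of value `+1`, and distinct pairs have disjoint sets of jump times. -/
def Gam (S : Type*) : Set (Edge S → CadlagPath ℕ) :=
  {K | (∀ x, ∃ f : CadlagPath ℕ, HasUnitJumps f ∧ ∀ t, siteCount K x t = (f.1 t : ℝ≥0∞)) ∧
    (∀ e, HasUnitJumps (K e)) ∧
    ∀ e e', e ≠ e' → Disjoint {t | IsJumpTime (K e) t} {t | IsJumpTime (K e') t}}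

/-- The jump times of the paths `𝒦_{x,y}`, `y ≠ x`. -/
def siteJumps (K : Edge S → CadlagPath ℕ) (x : S) : Set ℝ≥0 :=
  {t | ∃ y, ∃ h : x ≠ y, IsJumpTime (K (edge x y h)) t}

/-- `Output K x I y`: the backward algorithm, located at `x` and looking for jump times in the time
window `I`, stops after finitely many steps with output `y`. If no path `𝒦_{x,z}` jumps in `I` it
stops at `x`; otherwise it takes the last such jump time `s`, moves across the pair `{x, z}`
that jumps at time `s`, and goes on from `z` with the window `[0, s)`. -/
inductive Output (K : Edge S → CadlagPath ℕ) : S → Set ℝ≥0 → S → Prop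
  | halt (x : S) (I : Set ℝ≥0) (hI : I ∩ siteJumps K x = ∅) : Output K x I x
  | move (x z y : S) (I : Set ℝ≥0) (s : ℝ≥0) (hs : IsGreatest (I ∩ siteJumps K x) s)
      (hz : x ≠ z) (hj : IsJumpTime (K (edge x z hz)) s) (h : Output K z (Iio s) y) :
      Output K x I y

open Classical in
/-- `X_t^x[𝒦] ∈ S ∪ {∂}`: the output of the algorithm started at `x` with the window `[0, t]`, and
`∂ = none` if the algorithm does not stop. -/
def stirX (K : Edge S → CadlagPath ℕ) (t : ℝ≥0) (x : S) : Option S :=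
  if h : ∃ y, Output K x (Iic t) y then some h.choose else none

/-- The set `Γ_*` of those `𝒦 ∈ Γ` for which `X_t^x[𝒦] ∈ S` for all `x` and `t`. -/
def GamStar (S : Type*) : Set (Edge S → CadlagPath ℕ) :=
  {K | K ∈ Gam S ∧ ∀ x t, stirX K t x ≠ none}

/-- `η_t^σ[𝒦](x) = σ(X_t^x[𝒦])`. The value at `∂` is immaterial: only `𝒦 ∈ Γ_*` matters. -/
def eta (σ : S → Bool) (K : Edge S → CadlagPath ℕ) (t : ℝ≥0) : S → Bool :=
  fun x => (stirX K t x).elim false σ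

open Classical in
/-- The path `η^σ_·[𝒦]` as an element of `D(ℝ₊, {0,1}^S)` (a constant path if it is not càdlàg). -/
def etaPath (σ : S → Bool) (K : Edge S → CadlagPath ℕ) : CadlagPath (S → Bool) :=
  if h : IsCadlag (eta σ K) then ⟨eta σ K, h⟩ else ⟨fun _ => σ, isCadlag_const σ⟩

/-- `ℙ^σ(A) = ℙ(𝒦 ∈ Γ_* : η^σ_·[𝒦] ∈ A)`. -/
def ssepLaw (P : Measure (Edge S → CadlagPath ℕ)) (σ : S → Bool) :
    Measure (CadlagPath (S → Bool)) :=
  (P.restrict (GamStar S)).map (etaPath σ)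

end SSEP

end

/-!
Let `𝒦 ∈ Γ`. The jump times at a site are locally finite, so every move of the backward algorithm is
well defined, its output is unique (`Output.unique`), and everything reduces to the question whether
it stops. The algorithm depends on its window through the jump times at the current site only
(`Output.congr`); hence `η^σ` is càdlàg on `Γ_*` (`isCadlag_eta`), and stopping from all rational
times implies stopping from all times (`mem_GamStar_of_rat`).

*The algorithm stops a.s.* Looking backwards in time, the moves of the algorithm are those of the
random walk: the last jump at `x` before `t` is an exponential time of rate `c_x` away from `t`, it
leads to `y` with probability `c_{x,y} / c_x`, and the paths before that time are not affected. To
avoid conditioning on the last jump time, one move is discretised: for every fine mesh of `[0, t]`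
some pair `{x, z}` jumps in a cell `(a, b]` and nothing at `x` jumps in `(b, t]`
(`eventually_jumpBetween`). Three independent events, on `[0, a]`, `(a, b]` and `(b, t]`, bound the
probability of this (`IsGraphicalLaw.measure_jumpBetween_inter_le`). Summing over the cells and
letting the mesh tend to `0` shows that `n` moves within `[0, t]` are at most as likely as `n` jumps
of the walk up to time `t` (`IsGraphicalLaw.measure_survive_le`), where the latter probability is
identified through its first-step recursion (`walkLaw_sum_le`). Non-explosion makes it vanish for
`n → ∞`. Only this upper bound is needed, not the equality in law. The same discretisation shows
that the output depends measurably on `𝒦` (`measurableSet_output`).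

*Markov property.* Running the algorithm from time `r + t` amounts to running it over the window
`[0, t]` of the increments after `r`, and then over `[0, r]` (`Output.flow`). So `η_{r + ·}` is the
path started from `η_r` and driven by the increments after `r`, while `η` up to time `r` is a
function of the paths stopped at `r`. The increments are independent of the stopped paths and have
the law `ℙ` again (`isGraphicalLaw`), and Fubini's theorem yields the Markov property
(`IsGraphicalLaw.lintegral_ssepLaw`).
-/

namespace SSEP

/-! ### Counting paths with unit jumps -/

theorem CadlagPath.eventually_eq_right (f : CadlagPath ℕ) (t : ℝ≥0) :
    ∀ᶠ s in 𝓝[≥] t, f.1 s = f.1 t := by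
  have h := continuousWithinAt_Ioi_iff_Ici.1 (f.2 t).1
  have := h.tendsto
  rw [nhds_discrete, tendsto_pure] at this
  exact this

theorem CadlagPath.exists_eventually_eq_left (f : CadlagPath ℕ) (t : ℝ≥0) :
    ∃ l, ∀ᶠ s in 𝓝[<] t, f.1 s = l := by
  obtain ⟨l, hl⟩ := (f.2 t).2
  rw [nhds_discrete, tendsto_pure] at hl
  exact ⟨l, hl⟩

theorem isJumpTime_iff_left {f : CadlagPath ℕ} {t : ℝ≥0} :
    IsJumpTime f t ↔ ¬ ∀ᶠ s in 𝓝[<] t, f.1 s = f.1 t := by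
  unfold IsJumpTime
  rw [not_iff_not, ContinuousAt, nhds_discrete ℕ, tendsto_pure, ← nhdsLT_sup_nhdsGE,
    eventually_sup]
  exact and_iff_left (f.eventually_eq_right t)

theorem IsJumpTime.pos {f : CadlagPath ℕ} {t : ℝ≥0} (h : IsJumpTime f t) : 0 < t := by
  rw [isJumpTime_iff_left] at h
  by_contra h0
  obtain rfl : t = 0 := by simpa using h0
  exact h (by simp)

/-- A path with unit jumps is locally equal to `f t` or to `f t - 1` on the left of `t`. -/
theorem HasUnitJumps.exists_left {f : CadlagPath ℕ} (hf : HasUnitJumps f) (t : ℝ≥0) :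
    ∃ l, l ≤ f.1 t ∧ f.1 t ≤ l + 1 ∧ ∀ᶠ s in 𝓝[<] t, f.1 s = l := by
  by_cases h : IsJumpTime f t
  · have h1 := hf t h
    obtain ⟨l, hl⟩ := f.exists_eventually_eq_left t
    have ht := h.pos
    have : (𝓝[<] t).NeBot := nhdsLT_neBot_of_exists_lt ⟨0, ht⟩
    obtain ⟨s, hs, hs'⟩ := (h1.and hl).exists
    exact ⟨l, by omega, by omega, hl⟩
  · rw [isJumpTime_iff_left, not_not] at h
    exact ⟨f.1 t, le_rfl, by omega, h⟩

theorem HasUnitJumps.monotone {f : CadlagPath ℕ} (hf : HasUnitJumps f) : Monotone f.1 := by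
  intro a b hab
  have key : ∀ u, ∀ᶠ y in 𝓝 u, f.1 y ≤ f.1 u := by
    intro u
    rw [← nhdsLT_sup_nhdsGE, eventually_sup]
    obtain ⟨l, h1, -, h3⟩ := hf.exists_left u
    exact ⟨h3.mono fun y hy => hy.le.trans h1, (f.eventually_eq_right u).mono fun y hy => hy.le⟩
  have hcl : IsClosed ({u | f.1 a ≤ f.1 u} ∩ Icc a b) := by
    refine isClosed_of_closure_subset fun u hu => ⟨?_, ?_⟩
    · obtain ⟨y, hy, hy'⟩ := ((mem_closure_iff_frequently.1 hu).and_eventually (key u)).exists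
      exact le_trans hy.1 hy'
    · exact isClosed_Icc.closure_subset_iff.2 inter_subset_right hu
  refine hcl.Icc_subset_of_forall_mem_nhdsWithin (le_refl (f.1 a)) ?_ (right_mem_Icc.2 hab)
  rintro x ⟨hx, -⟩
  filter_upwards [(f.eventually_eq_right x).filter_mono (nhdsWithin_mono _ Ioi_subset_Ici_self)]
    with y hy
  simp only [Set.mem_ofPred_eq] at hx ⊢
  omega

theorem HasUnitJumps.isJumpTime_iff {f : CadlagPath ℕ} (hf : HasUnitJumps f) {s : ℝ≥0} :
    IsJumpTime f s ↔ 0 < s ∧ ∀ a < s, f.1 a < f.1 s := by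
  constructor
  · intro h
    have : (𝓝[<] s).NeBot := nhdsLT_neBot_of_exists_lt ⟨0, h.pos⟩
    refine ⟨h.pos, fun a ha => ?_⟩
    obtain ⟨u, hu, hu'⟩ := ((hf s h).and (Ioo_mem_nhdsLT ha)).exists
    have := hf.monotone hu'.1.le
    omega
  · rintro ⟨h0, h⟩
    rw [isJumpTime_iff_left]
    intro h1
    have : (𝓝[<] s).NeBot := nhdsLT_neBot_of_exists_lt ⟨0, h0⟩
    obtain ⟨u, hu, hu'⟩ := (h1.and self_mem_nhdsWithin).exists
    exact (h u hu').ne hu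

theorem eq_of_forall_not_isJumpTime {f : CadlagPath ℕ} {a b : ℝ≥0} (hab : a ≤ b)
    (h : ∀ s ∈ Ioc a b, ¬ IsJumpTime f s) : f.1 b = f.1 a := by
  have hc : ContinuousOn f.1 (Icc a b) := by
    intro s hs
    rcases hs.1.eq_or_lt with rfl | hlt
    · exact (continuousWithinAt_Ioi_iff_Ici.1 (f.2 a).1).mono Icc_subset_Ici_self
    · exact (not_not.1 (h s ⟨hlt, hs.2⟩)).continuousWithinAt
  exact isPreconnected_Icc.constant hc (right_mem_Icc.2 hab) (left_mem_Icc.2 hab)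

theorem exists_isJumpTime {f : CadlagPath ℕ} {a b : ℝ≥0} (hab : a ≤ b) (h : f.1 a ≠ f.1 b) :
    ∃ s ∈ Ioc a b, IsJumpTime f s := by
  by_contra! hc
  exact h (eq_of_forall_not_isJumpTime hab hc).symm

/-- A path with unit jumps has finitely many jumps in a bounded time interval. -/
theorem HasUnitJumps.finite_jumps {f : CadlagPath ℕ} (hf : HasUnitJumps f) (T : ℝ≥0) :
    ({s | IsJumpTime f s} ∩ Iic T).Finite := by
  refine Finite.of_finite_image ((finite_Iic (f.1 T)).subset ?_) (f := f.1) ?_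
  · rintro _ ⟨s, hs, rfl⟩
    exact hf.monotone hs.2
  · intro s hs u hu hsu
    by_contra hne
    rcases lt_or_gt_of_ne hne with h | h
    · exact ((hf.isJumpTime_iff.1 hu.1).2 s h).ne hsu
    · exact ((hf.isJumpTime_iff.1 hs.1).2 u h).ne hsu.symm

/-- Every `s ∈ (0, t]` lies in exactly one cell `(k h, (k + 1) h]` of the mesh `h = t / (m + 1)`. -/
theorem exists_mesh_cell {s t : ℝ≥0} (h0 : 0 < s) (hst : s ≤ t) (m : ℕ) :
    ∃ k ≤ m, (k : ℝ≥0) * (t / (m + 1)) < s ∧ s ≤ (k + 1 : ℕ) * (t / (m + 1)) := by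
  have ht : 0 < t := h0.trans_le hst
  have hh : 0 < t / (m + 1 : ℝ≥0) := by positivity
  have hc : 0 < ⌈s / (t / (m + 1 : ℝ≥0))⌉₊ := Nat.ceil_pos.2 (by positivity)
  obtain ⟨k, hk⟩ := Nat.exists_eq_succ_of_ne_zero hc.ne'
  have h1 := Nat.le_ceil (s / (t / (m + 1 : ℝ≥0)))
  have h2 : (k : ℝ≥0) < s / (t / (m + 1 : ℝ≥0)) := Nat.lt_ceil.1 (by omega)
  rw [hk] at h1
  have h3 : ⌈s / (t / (m + 1 : ℝ≥0))⌉₊ ≤ m + 1 := by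
    refine Nat.ceil_le.2 ?_
    rw [div_le_iff₀ hh]
    push_cast
    rw [mul_div_cancel₀ _ (by positivity)]
    exact hst
  refine ⟨k, by omega, (lt_div_iff₀ hh).1 h2, (div_le_iff₀ hh).1 h1⟩

theorem mesh_le {t : ℝ≥0} {k m : ℕ} (hk : k ≤ m) : ((k + 1 : ℕ) : ℝ≥0) * (t / (m + 1)) ≤ t := by
  have : ((k + 1 : ℕ) : ℝ≥0) ≤ m + 1 := by exact_mod_cast Nat.succ_le_succ hk
  calc ((k + 1 : ℕ) : ℝ≥0) * (t / (m + 1)) ≤ (m + 1) * (t / (m + 1)) := by gcongr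
    _ = t := mul_div_cancel₀ _ (by positivity)

theorem tendsto_mesh (t : ℝ≥0) : Tendsto (fun m : ℕ => t / (m + 1 : ℝ≥0)) atTop (𝓝 0) := by
  rw [← NNReal.tendsto_coe]
  have := (tendsto_const_div_atTop_nhds_zero_nat (t : ℝ)).comp (tendsto_add_atTop_nat 1)
  simpa [Function.comp_def] using this

/-- The increments of a path with unit jumps over small intervals are at most `1`. -/
theorem HasUnitJumps.exists_le_add_one {f : CadlagPath ℕ} (hf : HasUnitJumps f) (T : ℝ≥0) :
    ∃ δ > 0, ∀ u v : ℝ≥0, u ≤ v → v ≤ T → v < u + δ → f.1 v ≤ f.1 u + 1 := by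
  have key : ∀ t : ℝ≥0, ∃ U ∈ 𝓝 t, ∀ u ∈ U, ∀ v ∈ U, f.1 v ≤ f.1 u + 1 := by
    intro t
    obtain ⟨l, h1, h2, h3⟩ := hf.exists_left t
    refine ⟨{s | f.1 s = l ∨ f.1 s = f.1 t}, ?_, ?_⟩
    · rw [← nhdsLT_sup_nhdsGE]
      exact ⟨h3.mono fun _ => Or.inl, (f.eventually_eq_right t).mono fun _ => Or.inr⟩
    · rintro u (hu | hu) v (hv | hv) <;> omega
  choose U hU hUf using key
  obtain ⟨V, hV, h⟩ := lebesgue_number_lemma_nhds (K := Iic T) (U := U)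
    (by rw [← Icc_bot]; exact isCompact_Icc) (fun x _ => hU x)
  obtain ⟨δ, hδ, hδV⟩ := Metric.mem_uniformity_dist.1 hV
  refine ⟨⟨δ, hδ.le⟩, hδ, fun u v huv hvT hv => ?_⟩
  obtain ⟨y, hy⟩ := h u (huv.trans hvT)
  refine hUf _ u (hy (hδV (by simpa using hδ))) v (hy (hδV ?_))
  rw [NNReal.dist_eq, abs_lt]
  have h1 : (u : ℝ) ≤ v := huv
  have h2 : (v : ℝ) < u + δ := hv
  constructor <;> linarith

/-- The increments of `f` over the cells of the mesh `T / (m + 1)` of `[0, T]` are `0` or `1`. -/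
def UnitOnMesh (T : ℝ≥0) (m : ℕ) (f : ℝ≥0 → ℕ) : Prop :=
  ∀ k ≤ m, f (k * (T / (m + 1))) ≤ f ((k + 1 : ℕ) * (T / (m + 1))) ∧
    f ((k + 1 : ℕ) * (T / (m + 1))) ≤ f (k * (T / (m + 1))) + 1

theorem HasUnitJumps.eventually_unitOnMesh {f : CadlagPath ℕ} (hf : HasUnitJumps f) (T : ℝ≥0) :
    ∀ᶠ m in atTop, UnitOnMesh T m f.1 := by
  obtain ⟨δ, hδ, h⟩ := hf.exists_le_add_one T
  filter_upwards [(tendsto_mesh T).eventually (gt_mem_nhds hδ)] with m hm k hk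
  have hle : (k : ℝ≥0) * (T / (m + 1)) ≤ (k + 1 : ℕ) * (T / (m + 1)) := by gcongr; omega
  refine ⟨hf.monotone hle, h _ _ hle (mesh_le hk) ?_⟩
  push_cast
  rw [add_mul, one_mul]
  gcongr

/-- Around a jump of `f`, a fine mesh has a cell whose endpoints see the left limit and the value at
the jump; so unit increments over arbitrarily fine meshes force jumps of size one. -/
theorem hasUnitJumps_of_frequently {f : CadlagPath ℕ}
    (h : ∀ T : ℕ, ∃ᶠ m in atTop, UnitOnMesh T m f.1) : HasUnitJumps f := by
  intro t ht
  have h0 := ht.pos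
  have : (𝓝[<] t).NeBot := nhdsLT_neBot_of_exists_lt ⟨0, h0⟩
  obtain ⟨l, hl⟩ := f.exists_eventually_eq_left t
  have hne : l ≠ f.1 t := by
    rintro rfl
    exact isJumpTime_iff_left.1 ht hl
  obtain ⟨a, ha, ha'⟩ := (mem_nhdsLT_iff_exists_Ioo_subset' h0).1 hl
  obtain ⟨b, hb, hb'⟩ := (mem_nhdsGE_iff_exists_Ico_subset' (lt_add_one t)).1
    (f.eventually_eq_right t)
  obtain ⟨T, hT⟩ := exists_nat_ge t
  have e1 : ∀ᶠ m : ℕ in atTop, (T : ℝ≥0) / (m + 1 : ℝ≥0) < t - a :=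
    (tendsto_mesh T).eventually (gt_mem_nhds (tsub_pos_of_lt ha))
  have e2 : ∀ᶠ m : ℕ in atTop, (T : ℝ≥0) / (m + 1 : ℝ≥0) < b - t :=
    (tendsto_mesh T).eventually (gt_mem_nhds (tsub_pos_of_lt hb))
  obtain ⟨m, hm, h1, h2⟩ := ((h T).and_eventually (e1.and e2)).exists
  obtain ⟨k, hk, hk1, hk2⟩ := exists_mesh_cell h0 hT m
  have h3 := hm k hk
  rw [lt_tsub_iff_right] at h1 h2
  have hs : ((k + 1 : ℕ) : ℝ≥0) * ((T : ℝ≥0) / (m + 1)) =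
      k * ((T : ℝ≥0) / (m + 1)) + (T : ℝ≥0) / (m + 1) := by push_cast; ring
  have h4 : f.1 (k * ((T : ℝ≥0) / (m + 1))) = l := by
    refine ha' ⟨?_, hk1⟩
    by_contra! hc
    refine absurd (hk2.trans (hs.le.trans ?_)) h1.not_ge
    rw [add_comm]; gcongr
  have h5 : f.1 ((k + 1 : ℕ) * ((T : ℝ≥0) / (m + 1))) = f.1 t := by
    refine hb' ⟨hk2, lt_of_le_of_lt ?_ h2⟩
    rw [hs, add_comm]; gcongr
  rw [h4, h5] at h3
  filter_upwards [hl] with s hs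
  omega

theorem measurable_eval_path (t : ℝ≥0) : Measurable fun f : CadlagPath ℕ => f.1 t :=
  (measurable_pi_apply t).comp measurable_subtype_coe

theorem measurableSet_unitOnMesh (T : ℝ≥0) (m : ℕ) :
    MeasurableSet {f : CadlagPath ℕ | UnitOnMesh T m f.1} := by
  unfold UnitOnMesh
  simp only [ofPred_forall]
  refine MeasurableSet.iInter fun k => MeasurableSet.iInter fun _ => ?_
  exact (measurableSet_le (measurable_eval_path _) (measurable_eval_path _)).inter
    (measurableSet_le (measurable_eval_path _) ((measurable_eval_path _).add_const 1))

theorem measurableSet_hasUnitJumps : MeasurableSet {f : CadlagPath ℕ | HasUnitJumps f} := by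
  have : {f : CadlagPath ℕ | HasUnitJumps f} =
      {f | ∀ T : ℕ, ∃ N, ∀ m ≥ N, UnitOnMesh T m f.1} := by
    ext f
    refine ⟨fun hf T => eventually_atTop.1 (hf.eventually_unitOnMesh T), fun hf => ?_⟩
    exact hasUnitJumps_of_frequently fun T => (eventually_atTop.2 (hf T)).frequently
  rw [this]
  simp only [ofPred_forall, ofPred_exists]
  exact MeasurableSet.iInter fun T => MeasurableSet.iUnion fun N => MeasurableSet.iInter fun m =>
    MeasurableSet.iInter fun _ => measurableSet_unitOnMesh T m

/-! ### Sums, stopping and increments of paths -/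

/-- The sum of two counting paths. -/
def addPath (f g : CadlagPath ℕ) : CadlagPath ℕ :=
  ⟨fun t => f.1 t + g.1 t, fun t => ⟨(f.2 t).1.add (g.2 t).1, by
    obtain ⟨l, hl⟩ := (f.2 t).2
    obtain ⟨l', hl'⟩ := (g.2 t).2
    exact ⟨l + l', hl.add hl'⟩⟩⟩

theorem measurable_addPath : Measurable fun p : CadlagPath ℕ × CadlagPath ℕ => addPath p.1 p.2 := by
  refine Measurable.subtype_mk (measurable_pi_lambda _ fun t => ?_)
  exact ((measurable_eval_path t).comp measurable_fst).add
    ((measurable_eval_path t).comp measurable_snd)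

/-- Two paths with unit jumps have no common jump time iff their sum has unit jumps. -/
theorem disjoint_jumps_iff {f g : CadlagPath ℕ} (hf : HasUnitJumps f) (hg : HasUnitJumps g) :
    Disjoint {t | IsJumpTime f t} {t | IsJumpTime g t} ↔ HasUnitJumps (addPath f g) := by
  constructor
  · intro hd t ht
    by_cases h1 : IsJumpTime f t
    · have h2 : ¬ IsJumpTime g t := fun h2 => Set.disjoint_left.1 hd h1 h2
      rw [isJumpTime_iff_left, not_not] at h2
      filter_upwards [hf t h1, h2] with s hs1 hs2
      simp only [addPath]; omega
    · by_cases h2 : IsJumpTime g t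
      · rw [isJumpTime_iff_left, not_not] at h1
        filter_upwards [hg t h2, h1] with s hs1 hs2
        simp only [addPath]; omega
      · exact absurd (ContinuousAt.add (not_not.1 h1) (not_not.1 h2)) ht
  · intro h
    refine Set.disjoint_left.2 fun t h1 h2 => ?_
    have : (𝓝[<] t).NeBot := nhdsLT_neBot_of_exists_lt ⟨0, IsJumpTime.pos h1⟩
    obtain ⟨l, -, h3, h4⟩ := h.exists_left t
    obtain ⟨s, ha, hb, hc⟩ := ((hf t h1).and ((hg t h2).and h4)).exists
    simp only [addPath] at h3 hc
    omega

theorem IsCadlag.stopped {W : Type*} [TopologicalSpace W] {f : ℝ≥0 → W} (hf : IsCadlag f)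
    (r : ℝ≥0) : IsCadlag (fun s => f (min s r)) := by
  intro s
  rcases lt_or_ge s r with h | h
  · have e : (fun s => f (min s r)) =ᶠ[𝓝 s] f := by
      filter_upwards [gt_mem_nhds h] with u hu
      rw [min_eq_left hu.le]
    refine ⟨((hf s).1).congr_of_eventuallyEq (e.filter_mono nhdsWithin_le_nhds) ?_, ?_⟩
    · simp [h.le]
    · obtain ⟨l, hl⟩ := (hf s).2
      exact ⟨l, hl.congr' (e.filter_mono nhdsWithin_le_nhds).symm⟩
  · refine ⟨?_, ?_⟩
    · refine (continuousWithinAt_const (b := f r)).congr (fun u hu => ?_) ?_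
      · rw [min_eq_right (h.trans (le_of_lt hu))]
      · simp only [min_eq_right h]
    · rcases h.eq_or_lt with rfl | h
      · obtain ⟨l, hl⟩ := (hf r).2
        refine ⟨l, hl.congr' ?_⟩
        filter_upwards [self_mem_nhdsWithin] with u hu
        rw [min_eq_left (le_of_lt hu)]
      · refine ⟨f r, tendsto_const_nhds.congr' ?_⟩
        filter_upwards [nhdsWithin_le_nhds (lt_mem_nhds h)] with u hu
        rw [min_eq_right (le_of_lt hu)]

/-- The path stopped at time `r`. -/
def stopPath (r : ℝ≥0) (f : CadlagPath ℕ) : CadlagPath ℕ := ⟨fun s => f.1 (min s r), f.2.stopped r⟩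

/-- The path of the increments after time `r` (with truncated subtraction, which is immaterial for
nondecreasing paths). -/
def incPath (r : ℝ≥0) (f : CadlagPath ℕ) : CadlagPath ℕ :=
  ⟨fun s => f.1 (r + s) - f.1 r, fun s => by
    have hc : Continuous fun n : ℕ => n - f.1 r := continuous_of_discreteTopology
    have h := f.2.shift r s
    refine ⟨hc.continuousAt.comp_continuousWithinAt h.1, ?_⟩
    obtain ⟨l, hl⟩ := h.2
    exact ⟨_, (hc.tendsto l).comp hl⟩⟩

theorem measurable_stopPath (r : ℝ≥0) : Measurable (stopPath r) :=
  Measurable.subtype_mk (measurable_pi_lambda _ fun _ => measurable_eval_path _)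

theorem measurable_incPath (r : ℝ≥0) : Measurable (incPath r) :=
  Measurable.subtype_mk (measurable_pi_lambda _ fun s =>
    (measurable_eval_path (r + s)).sub (measurable_eval_path r))

theorem isJumpTime_stopPath {f : CadlagPath ℕ} {r s : ℝ≥0} :
    IsJumpTime (stopPath r f) s ↔ IsJumpTime f s ∧ s ≤ r := by
  rcases le_or_gt s r with h | h
  · rw [isJumpTime_iff_left, isJumpTime_iff_left, and_iff_left h, not_iff_not]
    refine eventually_congr ?_
    filter_upwards [self_mem_nhdsWithin] with u hu
    simp only [stopPath]
    rw [min_eq_left h, min_eq_left ((le_of_lt hu).trans h)]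
  · refine iff_of_false ?_ fun hc => hc.2.not_gt h
    rw [isJumpTime_iff_left, not_not]
    filter_upwards [nhdsWithin_le_nhds (lt_mem_nhds h)] with u hu
    simp only [stopPath]
    rw [min_eq_right (le_of_lt hu), min_eq_right h.le]

theorem HasUnitJumps.stopPath {f : CadlagPath ℕ} (hf : HasUnitJumps f) (r : ℝ≥0) :
    HasUnitJumps (stopPath r f) := by
  intro s hs
  obtain ⟨h1, h2⟩ := isJumpTime_stopPath.1 hs
  filter_upwards [hf s h1, self_mem_nhdsWithin] with u hu hu'
  simp only [SSEP.stopPath]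
  rwa [min_eq_left h2, min_eq_left ((le_of_lt hu').trans h2)]

theorem eventually_nhdsLT_add {p : ℝ≥0 → Prop} {r s : ℝ≥0} (hs : 0 < s) :
    (∀ᶠ u in 𝓝[<] (r + s), p u) ↔ ∀ᶠ u in 𝓝[<] s, p (r + u) := by
  constructor
  · intro h
    have hc : Continuous fun s : ℝ≥0 => r + s := by fun_prop
    have : Tendsto (fun s : ℝ≥0 => r + s) (𝓝[<] s) (𝓝[<] (r + s)) :=
      tendsto_nhdsWithin_iff.2 ⟨hc.continuousWithinAt, by
        filter_upwards [self_mem_nhdsWithin] with u hu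
        exact add_lt_add_right (mem_Iio.1 hu) r⟩
    exact this.eventually h
  · intro h
    obtain ⟨a, ha, ha'⟩ := (mem_nhdsLT_iff_exists_Ioo_subset' hs).1 h
    filter_upwards [Ioo_mem_nhdsLT (add_lt_add_right (mem_Iio.1 ha) r)] with u hu
    have hru : r ≤ u := le_self_add.trans hu.1.le
    have : p (r + (u - r)) := by
      refine ha' ⟨?_, ?_⟩
      · exact lt_tsub_of_add_lt_left hu.1
      · exact (tsub_lt_iff_left hru).2 hu.2
    rwa [add_tsub_cancel_of_le hru] at this

theorem HasUnitJumps.isJumpTime_incPath {f : CadlagPath ℕ} (hf : HasUnitJumps f) {r s : ℝ≥0} :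
    IsJumpTime (incPath r f) s ↔ 0 < s ∧ IsJumpTime f (r + s) := by
  by_cases h0 : 0 < s
  · rw [isJumpTime_iff_left, isJumpTime_iff_left, and_iff_right h0, not_iff_not,
      eventually_nhdsLT_add h0]
    refine eventually_congr (Eventually.of_forall fun u => ?_)
    have h1 := hf.monotone (le_self_add : r ≤ r + u)
    have h2 := hf.monotone (le_self_add : r ≤ r + s)
    simp only [incPath]
    omega
  · exact iff_of_false (fun h => h0 h.pos) fun h => h0 h.1

theorem HasUnitJumps.incPath {f : CadlagPath ℕ} (hf : HasUnitJumps f) (r : ℝ≥0) :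
    HasUnitJumps (incPath r f) := by
  intro s hs
  obtain ⟨h0, h1⟩ := hf.isJumpTime_incPath.1 hs
  have h2 := (eventually_nhdsLT_add h0).1 (hf _ h1)
  filter_upwards [h2] with u hu
  have h1 := hf.monotone (le_self_add : r ≤ r + u)
  simp only [SSEP.incPath]
  omega

end SSEP

namespace SSEP

variable {S : Type*}

/-! ### The set of admissible path families -/

theorem edge_eq_iff {x y x' y' : S} {h : x ≠ y} {h' : x' ≠ y'} :
    edge x y h = edge x' y' h' ↔ (x = x' ∧ y = y') ∨ (x = y' ∧ y = x') := by
  simp [edge, Subtype.ext_iff]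

theorem edge_right_injective {x y z : S} {h : x ≠ y} {h' : x ≠ z} (he : edge x y h = edge x z h') :
    y = z := by
  rcases edge_eq_iff.1 he with h1 | h1
  · exact h1.2
  · exact absurd h1.1 h'

theorem siteCount_mono {K : Edge S → CadlagPath ℕ} (hK : ∀ e, HasUnitJumps (K e)) (x : S) :
    Monotone (siteCount K x) := by
  intro s t hst
  refine ENNReal.tsum_le_tsum fun y => ?_
  split_ifs with h
  · exact_mod_cast (hK _).monotone hst
  · exact le_rfl

/-- If the count at `x` is finite at time `T`, only finitely many pairs `{x, y}` have a path that is
nonzero at time `T`. -/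
theorem finite_ne_zero_of_siteCount {K : Edge S → CadlagPath ℕ} {x : S} {T : ℝ≥0}
    (h : siteCount K x T ≠ ∞) : {y | ∃ h : x ≠ y, (K (edge x y h)).1 T ≠ 0}.Finite := by
  classical
  have h1 := ENNReal.finite_const_le_of_tsum_ne_top h one_ne_zero
  refine h1.subset ?_
  rintro y ⟨hy, hy'⟩
  simp only [Set.mem_ofPred_eq, dif_pos hy]
  exact_mod_cast Nat.one_le_iff_ne_zero.2 hy'

theorem siteCount_lt_top_of_finite {K : Edge S → CadlagPath ℕ} {x : S} {T : ℝ≥0}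
    (h : {y | ∃ h : x ≠ y, (K (edge x y h)).1 T ≠ 0}.Finite) : siteCount K x T ≠ ∞ := by
  classical
  rw [siteCount, tsum_eq_sum (s := h.toFinset)]
  · refine ENNReal.sum_ne_top.2 fun y _ => ?_
    split_ifs <;> simp
  · intro y hy
    split_ifs with hxy
    · by_contra hc
      exact hy (h.mem_toFinset.2 ⟨hxy, by simpa using hc⟩)
    · rfl

/-- A finite sum of counting paths. -/
def sumPath {ι : Type*} (F : Finset ι) (c : ι → CadlagPath ℕ) : CadlagPath ℕ :=
  ⟨fun t => ∑ i ∈ F, (c i).1 t, fun t => by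
    refine ⟨tendsto_finsetSum _ fun i _ => ((c i).2 t).1, ?_⟩
    choose l hl using fun i => ((c i).2 t).2
    exact ⟨_, tendsto_finsetSum F fun i _ => hl i⟩⟩

theorem HasUnitJumps.sumPath {ι : Type*} {F : Finset ι} {c : ι → CadlagPath ℕ}
    (h1 : ∀ i, HasUnitJumps (c i))
    (h2 : ∀ i j, i ≠ j → ∀ t, IsJumpTime (c i) t → ¬ IsJumpTime (c j) t) :
    HasUnitJumps (sumPath F c) := by
  classical
  intro t ht
  obtain ⟨i, hi, hit⟩ : ∃ i ∈ F, IsJumpTime (c i) t := by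
    by_contra! hc
    exact ht (tendsto_finsetSum _ fun i hi => not_not.1 (hc i hi))
  have h3 : ∀ᶠ s in 𝓝[<] t, ∀ j ∈ F.erase i, (c j).1 s = (c j).1 t := by
    refine (eventually_all_finset _).2 fun j hj => ?_
    have := h2 i j (Finset.ne_of_mem_erase hj).symm t hit
    rwa [isJumpTime_iff_left, not_not] at this
  filter_upwards [h3, h1 i t hit] with s hs hs'
  simp only [SSEP.sumPath]
  rw [← Finset.add_sum_erase _ _ hi, ← Finset.add_sum_erase _ _ hi, Finset.sum_congr rfl hs, hs']
  ring

open Classical in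
/-- The path of the pair `{x, y}`, or the zero path if `y = x`. -/
noncomputable def pairPath (K : Edge S → CadlagPath ℕ) (x y : S) : CadlagPath ℕ :=
  if h : x ≠ y then K (edge x y h) else ⟨fun _ => 0, isCadlag_const 0⟩

theorem isJumpTime_pairPath {K : Edge S → CadlagPath ℕ} {x y : S} {t : ℝ≥0} :
    IsJumpTime (pairPath K x y) t ↔ ∃ h : x ≠ y, IsJumpTime (K (edge x y h)) t := by
  unfold pairPath
  split_ifs with h
  · simp [h]
  · exact iff_of_false (fun hc => hc continuousAt_const) fun hc => h hc.1

theorem hasUnitJumps_pairPath {K : Edge S → CadlagPath ℕ} (hK : ∀ e, HasUnitJumps (K e))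
    (x y : S) : HasUnitJumps (pairPath K x y) := by
  unfold pairPath
  split_ifs with h
  · exact hK _
  · exact fun t ht => absurd continuousAt_const ht

theorem siteCount_eq_tsum_pairPath (K : Edge S → CadlagPath ℕ) (x : S) (t : ℝ≥0) :
    siteCount K x t = ∑' y, ((pairPath K x y).1 t : ℝ≥0∞) := by
  refine tsum_congr fun y => ?_
  unfold pairPath
  split_ifs <;> simp

/-- Membership in `Γ` amounts to unit jumps, finite counts at all sites, and disjoint jump times;
the regularity of the counts is then automatic, since locally they are finite sums. -/
theorem mem_Gam_iff {K : Edge S → CadlagPath ℕ} : K ∈ Gam S ↔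
    (∀ e, HasUnitJumps (K e)) ∧ (∀ x, ∀ T : ℕ, siteCount K x T ≠ ∞) ∧
      ∀ e e', e ≠ e' → Disjoint {t | IsJumpTime (K e) t} {t | IsJumpTime (K e') t} := by
  classical
  constructor
  · rintro ⟨h1, h2, h3⟩
    refine ⟨h2, fun x T => ?_, h3⟩
    obtain ⟨f, -, hf⟩ := h1 x
    rw [hf]
    simp
  · rintro ⟨h1, h2, h3⟩
    refine ⟨fun x => ?_, h1, h3⟩
    have hfin : ∀ t : ℝ≥0, siteCount K x t ≠ ∞ := fun t => by
      obtain ⟨T, hT⟩ := exists_nat_ge t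
      exact ((siteCount_mono h1 x hT).trans_lt (h2 x T).lt_top).ne
    -- up to time `T` only finitely many neighbours contribute to the sum
    have hloc : ∀ T, ∃ F : Finset S, ∀ t ≤ T,
        siteCount K x t = (((sumPath F (pairPath K x)).1 t : ℕ) : ℝ≥0∞) := by
      intro T
      refine ⟨(finite_ne_zero_of_siteCount (hfin T)).toFinset, fun t ht => ?_⟩
      rw [siteCount_eq_tsum_pairPath,
        tsum_eq_sum (s := (finite_ne_zero_of_siteCount (hfin T)).toFinset)]
      · simp only [sumPath]
        push_cast
        rfl
      · intro y hy
        by_cases hxy : x ≠ y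
        · by_contra hc
          refine hy ((Finite.mem_toFinset _).2 ⟨hxy, fun h0 => hc ?_⟩)
          have := (h1 (edge x y hxy)).monotone ht
          have h00 : (K (edge x y hxy)).1 t = 0 := by omega
          rw [pairPath, dif_pos hxy, h00]; simp
        · rw [pairPath, dif_neg hxy]; simp
    choose F hF using hloc
    have hu : ∀ T, HasUnitJumps (sumPath (F T) (pairPath K x)) := fun T => by
      refine HasUnitJumps.sumPath (hasUnitJumps_pairPath h1 x) fun y z hyz t hy hz => ?_
      obtain ⟨hxy, hy⟩ := isJumpTime_pairPath.1 hy
      obtain ⟨hxz, hz⟩ := isJumpTime_pairPath.1 hz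
      exact Set.disjoint_left.1 (h3 _ _ fun he => hyz (edge_right_injective he)) hy hz
    let f : ℝ≥0 → ℕ := fun t => (sumPath (F t) (pairPath K x)).1 t
    have hf : ∀ t T, t ≤ T → f t = (sumPath (F T) (pairPath K x)).1 t := fun t T htT => by
      have := (hF t t le_rfl).symm.trans (hF T t htT)
      exact_mod_cast this
    have hev : ∀ t, f =ᶠ[𝓝 t] (sumPath (F (t + 1)) (pairPath K x)).1 := fun t => by
      filter_upwards [gt_mem_nhds (lt_add_one t)] with s hs
      exact hf s _ hs.le
    have hcad : IsCadlag f := fun t => by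
      have h := (sumPath (F (t + 1)) (pairPath K x)).2 t
      refine ⟨h.1.congr_of_eventuallyEq ((hev t).filter_mono nhdsWithin_le_nhds) (hev t).eq_of_nhds,
        ?_⟩
      obtain ⟨l, hl⟩ := h.2
      exact ⟨l, hl.congr' ((hev t).symm.filter_mono nhdsWithin_le_nhds)⟩
    refine ⟨⟨f, hcad⟩, fun t ht => ?_, fun t => hF t t le_rfl⟩
    have ht' : IsJumpTime (sumPath (F (t + 1)) (pairPath K x)) t := fun hc =>
      ht (hc.congr (hev t).symm)
    filter_upwards [hu (t + 1) t ht', (hev t).filter_mono nhdsWithin_le_nhds] with s hs hs'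
    simp only [hs', (hev t).eq_of_nhds, hs]

section Measurability

variable [Countable S]

theorem measurable_siteCount (x : S) (t : ℝ≥0) :
    Measurable fun K : Edge S → CadlagPath ℕ => siteCount K x t := by
  classical
  unfold siteCount
  refine Measurable.tsum fun y => ?_
  by_cases h : x ≠ y
  · simp only [dif_pos h]
    exact measurable_from_top.comp ((measurable_eval_path t).comp (measurable_pi_apply _))
  · simp only [dif_neg h, measurable_const]

theorem measurableSet_Gam : MeasurableSet (Gam S) := by
  have : Gam S = {K | ∀ e, HasUnitJumps (K e)} ∩ ({K | ∀ x, ∀ T : ℕ, siteCount K x T ≠ ∞} ∩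
      {K | ∀ e e', e ≠ e' → HasUnitJumps (addPath (K e) (K e'))}) := by
    ext K
    rw [mem_Gam_iff]
    refine and_congr_right fun h1 => and_congr_right fun _ => ?_
    exact forall₃_congr fun e e' _ => disjoint_jumps_iff (h1 e) (h1 e')
  rw [this]
  have hm : ∀ e, Measurable fun K : Edge S → CadlagPath ℕ => K e := fun e => measurable_pi_apply e
  refine MeasurableSet.inter ?_ (MeasurableSet.inter ?_ ?_)
  · simp only [ofPred_forall]
    exact MeasurableSet.iInter fun e => hm e measurableSet_hasUnitJumps
  · simp only [ofPred_forall]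
    exact MeasurableSet.iInter fun x => MeasurableSet.iInter fun T =>
      (measurable_siteCount x T) (measurableSet_singleton ∞).compl
  · simp only [ofPred_forall]
    refine MeasurableSet.iInter fun e => MeasurableSet.iInter fun e' =>
      MeasurableSet.iInter fun _ => ?_
    exact (measurable_addPath.comp ((hm e).prodMk (hm e')))
      measurableSet_hasUnitJumps

end Measurability

/-! ### The backward algorithm -/

variable {K : Edge S → CadlagPath ℕ}

theorem siteJumps_finite (hK : K ∈ Gam S) (x : S) (T : ℝ≥0) : (siteJumps K x ∩ Iic T).Finite := by
  classical
  have h1 := hK.1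
  have hu := hK.2.1
  obtain ⟨f, hf, hfK⟩ := h1 x
  refine (hf.finite_jumps T).subset (inter_subset_inter_left _ ?_)
  rintro s ⟨y, hxy, hs⟩
  obtain ⟨h0, hs⟩ := (hu _).isJumpTime_iff.1 hs
  refine hf.isJumpTime_iff.2 ⟨h0, fun a ha => ?_⟩
  have hne : siteCount K x a ≠ ∞ := by rw [hfK]; simp
  have : siteCount K x a < siteCount K x s := by
    rw [siteCount_eq_tsum_pairPath] at hne ⊢
    rw [siteCount_eq_tsum_pairPath]
    refine ENNReal.tsum_lt_tsum hne (i := y) (fun z => ?_) ?_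
    · exact_mod_cast (hasUnitJumps_pairPath hu x z).monotone ha.le
    · rw [pairPath, dif_pos hxy]
      exact_mod_cast hs a ha
  rw [hfK, hfK] at this
  exact_mod_cast this

theorem pos_of_mem_siteJumps {x : S} {s : ℝ≥0} (h : s ∈ siteJumps K x) : 0 < s :=
  h.choose_spec.choose_spec.pos

/-- The last jump time at `x` in a bounded time window exists, unless there is none at all. -/
theorem exists_isGreatest (hK : K ∈ Gam S) {x : S} {I : Set ℝ≥0} {T : ℝ≥0} (hI : I ⊆ Iic T)
    (hne : (I ∩ siteJumps K x).Nonempty) : ∃ s, IsGreatest (I ∩ siteJumps K x) s := by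
  have hfin : (I ∩ siteJumps K x).Finite :=
    (siteJumps_finite hK x T).subset fun s hs => ⟨hs.2, hI hs.1⟩
  obtain ⟨s, hs, h⟩ := hfin.exists_maximalFor id _ hne
  refine ⟨s, hs, fun u hu => ?_⟩
  by_contra! hc
  exact hc.not_ge (h hu hc.le)

/-- The neighbour across which a jump at `x` takes place is unique. -/
theorem jump_unique (hK : K ∈ Gam S) {x y z : S} {s : ℝ≥0} {hy : x ≠ y} {hz : x ≠ z}
    (h1 : IsJumpTime (K (edge x y hy)) s) (h2 : IsJumpTime (K (edge x z hz)) s) : y = z := by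
  by_contra hne
  exact Set.disjoint_left.1 (hK.2.2 _ _ fun he => hne (edge_right_injective he)) h1 h2

theorem jump_mem_siteJumps {x z : S} {hz : x ≠ z} {s : ℝ≥0}
    (h : IsJumpTime (K (edge x z hz)) s) : s ∈ siteJumps K x :=
  ⟨z, hz, h⟩

/-- The algorithm sees its window through the jump times at the current site only. -/
theorem Output.congr {x y : S} {I J : Set ℝ≥0} (h : Output K x I y)
    (hIJ : I ∩ siteJumps K x = J ∩ siteJumps K x) : Output K x J y := by
  cases h with
  | halt _ _ hI => exact Output.halt x J (hIJ ▸ hI)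
  | move _ z _ _ s hs hz hj h => exact Output.move x z y J s (hIJ ▸ hs) hz hj h

theorem Output.unique (hK : K ∈ Gam S) {x y : S} {I : Set ℝ≥0} (h : Output K x I y) :
    ∀ {y'}, Output K x I y' → y = y' := by
  induction h with
  | halt x I hI =>
    intro y' h'
    cases h' with
    | halt => rfl
    | move _ z _ _ s hs => exact absurd hs.1 (by rw [hI]; exact notMem_empty s)
  | move x z y I s hs hz hj h ih =>
    intro y' h'
    cases h' with
    | halt _ _ hI => exact absurd hs.1 (by rw [hI]; exact notMem_empty s)
    | move _ z' _ _ s' hs' hz' hj' h' =>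
      obtain rfl := hs.unique hs'
      obtain rfl := jump_unique hK hj hj'
      exact ih h'

theorem stirX_ne_none_iff {x : S} {t : ℝ≥0} : stirX K t x ≠ none ↔ ∃ y, Output K x (Iic t) y := by
  unfold stirX
  split_ifs with h
  · simpa using h
  · simpa using h

theorem stirX_eq_some_iff (hK : K ∈ Gam S) {x y : S} {t : ℝ≥0} :
    stirX K t x = some y ↔ Output K x (Iic t) y := by
  unfold stirX
  split_ifs with h
  · rw [Option.some_inj]
    exact ⟨fun he => he ▸ h.choose_spec, fun hy => h.choose_spec.unique hK hy⟩
  · exact iff_of_false (by simp) fun hy => h ⟨y, hy⟩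

theorem mem_GamStar_iff : K ∈ GamStar S ↔ K ∈ Gam S ∧ ∀ x t, ∃ y, Output K x (Iic t) y := by
  simp only [GamStar, Set.mem_ofPred_eq, stirX_ne_none_iff]

/-- No jump at `x` occurs in some interval `(t, t + δ)`. -/
theorem exists_no_jump_right (hK : K ∈ Gam S) (x : S) (t : ℝ≥0) :
    ∃ u > t, ∀ s ∈ siteJumps K x, t < s → u < s := by
  have hfin := (siteJumps_finite hK x (t + 1)).subset
    (fun s (hs : s ∈ siteJumps K x ∩ Ioc t (t + 1)) => ⟨hs.1, hs.2.2⟩)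
  obtain ⟨v, hv, hv'⟩ : ∃ v > t, ∀ s ∈ siteJumps K x ∩ Ioc t (t + 1), v ≤ s := by
    by_cases hne : (siteJumps K x ∩ Ioc t (t + 1)).Nonempty
    · obtain ⟨v, hv, h⟩ := hfin.exists_minimalFor id _ hne
      refine ⟨v, hv.2.1, fun s hs => ?_⟩
      by_contra! hc
      exact hc.not_ge (h hs hc.le)
    · exact ⟨t + 1, lt_add_one t, fun s hs => absurd ⟨s, hs⟩ hne⟩
  obtain ⟨u, hu, hu'⟩ := exists_between (lt_min hv (lt_add_one t))
  refine ⟨u, hu, fun s hs hts => ?_⟩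
  by_cases h : s ≤ t + 1
  · exact (hu'.trans_le (min_le_left _ _)).trans_le (hv' s ⟨hs, hts, h⟩)
  · exact (hu'.trans_le (min_le_right _ _)).trans (not_le.1 h)

/-- No jump at `x` occurs in some interval `[u, t)` with `u < t`. -/
theorem exists_no_jump_left (hK : K ∈ Gam S) (x : S) {t : ℝ≥0} (ht : 0 < t) :
    ∃ u < t, ∀ s ∈ siteJumps K x, s < t → s < u := by
  have hfin := (siteJumps_finite hK x t).subset
    (fun s (hs : s ∈ siteJumps K x ∩ Iio t) => ⟨hs.1, (le_of_lt hs.2 : s ≤ t)⟩)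
  by_cases hne : (siteJumps K x ∩ Iio t).Nonempty
  · obtain ⟨v, hv, h⟩ := hfin.exists_maximalFor id _ hne
    obtain ⟨u, hu, hu'⟩ := exists_between (show v < t from hv.2)
    refine ⟨u, hu', fun s hs hst => lt_of_le_of_lt ?_ hu⟩
    by_contra! hc
    exact hc.not_ge (h ⟨hs, hst⟩ hc.le)
  · exact ⟨0, ht, fun s hs hst => absurd ⟨s, hs, hst⟩ hne⟩

/-- If the algorithm stops from all rational times then it stops from all times. -/
theorem mem_GamStar_of_rat (hK : K ∈ Gam S)
    (h : ∀ x, ∀ q : ℚ≥0, ∃ y, Output K x (Iic (q : ℝ≥0)) y) : K ∈ GamStar S := by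
  refine mem_GamStar_iff.2 ⟨hK, fun x t => ?_⟩
  obtain ⟨u, hu, hu'⟩ := exists_no_jump_right hK x t
  obtain ⟨q, hq, hq'⟩ : ∃ q : ℚ≥0, t < (q : ℝ≥0) ∧ (q : ℝ≥0) < u := by
    obtain ⟨q, hq, hq'⟩ := exists_rat_btwn (show (t : ℝ) < u from hu)
    have h0 : 0 ≤ q := by exact_mod_cast (t.2.trans hq.le)
    exact ⟨⟨q, h0⟩, by exact_mod_cast hq, by exact_mod_cast hq'⟩
  obtain ⟨y, hy⟩ := h x q
  refine ⟨y, hy.congr ?_⟩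
  ext s
  refine and_congr_left fun hs => ⟨fun hsq => ?_, fun hst => le_trans hst hq.le⟩
  by_contra hc
  exact absurd (hu' s hs (not_le.1 hc)) (not_lt.2 (le_trans hsq hq'.le))

/-- The algorithm from `(x, t)` is locally constant in `t` away from the jump times at `x`, which
are locally finite; the topology of `{0,1}^S` only requires this for one `x` at a time. -/
theorem isCadlag_eta (hK : K ∈ GamStar S) (σ : S → Bool) : IsCadlag (eta σ K) := by
  obtain ⟨hG, hK⟩ := mem_GamStar_iff.1 hK
  have key : ∀ x t u, Iic t ∩ siteJumps K x = Iic u ∩ siteJumps K x →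
      eta σ K t x = eta σ K u x := by
    intro x t u h
    obtain ⟨y, hy⟩ := hK x t
    simp only [eta, (stirX_eq_some_iff hG).2 hy, (stirX_eq_some_iff hG).2 (hy.congr h)]
  intro t
  constructor
  · rw [ContinuousWithinAt, tendsto_pi_nhds]
    intro x
    obtain ⟨u, hu, hu'⟩ := exists_no_jump_right hG x t
    refine tendsto_const_nhds.congr' ?_
    filter_upwards [Ioo_mem_nhdsGT hu] with v hv
    refine key x t v ?_
    ext s
    refine and_congr_left fun hs => ⟨fun hst => le_trans hst hv.1.le, fun hsv => ?_⟩
    by_contra hc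
    exact absurd (hu' s hs (not_le.1 hc)) (not_lt.2 (le_trans hsv hv.2.le))
  · rcases eq_zero_or_pos t with rfl | ht
    · exact ⟨fun _ => false, by simp⟩
    have : ∀ x, ∃ l, Tendsto (fun s => eta σ K s x) (𝓝[<] t) (𝓝 l) := by
      intro x
      obtain ⟨u, hu, hu'⟩ := exists_no_jump_left hG x ht
      refine ⟨eta σ K u x, tendsto_const_nhds.congr' ?_⟩
      filter_upwards [Ico_mem_nhdsLT hu] with v hv
      refine key x u v ?_
      ext s
      refine and_congr_left fun hs => ⟨fun hsu => le_trans hsu hv.1, fun hsv => ?_⟩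
      exact (hu' s hs (lt_of_le_of_lt hsv hv.2)).le
    choose l hl using this
    exact ⟨l, tendsto_pi_nhds.2 hl⟩

/-! ### Stopping and shifting the driving paths -/

/-- All paths stopped at time `r`. -/
def stopAll (r : ℝ≥0) (K : Edge S → CadlagPath ℕ) : Edge S → CadlagPath ℕ :=
  fun e => stopPath r (K e)

/-- The increments of all paths after time `r`. -/
def incAll (r : ℝ≥0) (K : Edge S → CadlagPath ℕ) : Edge S → CadlagPath ℕ :=
  fun e => incPath r (K e)

theorem measurable_stopAll (r : ℝ≥0) : Measurable (stopAll (S := S) r) :=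
  measurable_pi_lambda _ fun e => (measurable_stopPath r).comp (measurable_pi_apply e)

theorem measurable_incAll (r : ℝ≥0) : Measurable (incAll (S := S) r) :=
  measurable_pi_lambda _ fun e => (measurable_incPath r).comp (measurable_pi_apply e)

theorem stopAll_mem_Gam (hK : K ∈ Gam S) (r : ℝ≥0) : stopAll r K ∈ Gam S := by
  rw [mem_Gam_iff] at hK ⊢
  refine ⟨fun e => (hK.1 e).stopPath r, fun x T => ?_, fun e e' he => ?_⟩
  · refine ((ENNReal.tsum_le_tsum fun y => ?_).trans_lt (hK.2.1 x T).lt_top).ne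
    split_ifs
    · exact_mod_cast (hK.1 _).monotone (min_le_left _ _)
    · exact le_rfl
  · refine (hK.2.2 e e' he).mono ?_ ?_ <;> exact fun t ht => (isJumpTime_stopPath.1 ht).1

theorem incAll_mem_Gam (hK : K ∈ Gam S) (r : ℝ≥0) : incAll r K ∈ Gam S := by
  have hK' := hK
  rw [mem_Gam_iff] at hK ⊢
  refine ⟨fun e => (hK.1 e).incPath r, fun x T => ?_, fun e e' he => ?_⟩
  · obtain ⟨f, -, hf⟩ := hK'.1 x
    have : siteCount K x (r + T) ≠ ∞ := by rw [hf]; simp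
    refine ((ENNReal.tsum_le_tsum fun y => ?_).trans_lt this.lt_top).ne
    split_ifs
    · exact_mod_cast Nat.sub_le _ _
    · exact le_rfl
  · refine Set.disjoint_left.2 fun t h1 h2 => ?_
    exact Set.disjoint_left.1 (hK.2.2 e e' he) ((hK.1 e).isJumpTime_incPath.1 h1).2
      ((hK.1 e').isJumpTime_incPath.1 h2).2

theorem mem_siteJumps_stopAll {r s : ℝ≥0} {x : S} :
    s ∈ siteJumps (stopAll r K) x ↔ s ∈ siteJumps K x ∧ s ≤ r := by
  simp only [siteJumps, stopAll, Set.mem_ofPred_eq, isJumpTime_stopPath]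
  simp only [← exists_and_right]

theorem mem_siteJumps_incAll (hK : K ∈ Gam S) {r s : ℝ≥0} {x : S} :
    s ∈ siteJumps (incAll r K) x ↔ 0 < s ∧ r + s ∈ siteJumps K x := by
  simp only [siteJumps, incAll, Set.mem_ofPred_eq, (hK.2.1 _).isJumpTime_incPath]
  simp only [exists_and_left]

theorem Output.stopAll {r : ℝ≥0} {x y : S} {I : Set ℝ≥0} (h : Output K x I y) :
    ∀ J : Set ℝ≥0, J ∩ siteJumps (stopAll r K) x = I ∩ siteJumps K x →
      Output (stopAll r K) x J y := by
  induction h with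
  | halt x I hI => exact fun J hJ => Output.halt x J (hJ.trans hI)
  | move x z y I s hs hz hj h ih =>
    intro J hJ
    have hs' := hJ ▸ hs
    have hsr : s ≤ r := (mem_siteJumps_stopAll.1 hs'.1.2).2
    refine Output.move x z y J s hs' hz (isJumpTime_stopPath.2 ⟨hj, hsr⟩) (ih _ ?_)
    ext u
    refine and_congr_right fun hu => ?_
    rw [mem_siteJumps_stopAll]
    exact and_iff_left ((le_of_lt hu).trans hsr)

theorem output_stopAll {r t : ℝ≥0} {x y : S} (h : Output K x (Iic (min t r)) y) :
    Output (SSEP.stopAll r K) x (Iic t) y := by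
  refine h.stopAll _ ?_
  ext u
  simp only [mem_inter_iff, mem_siteJumps_stopAll, mem_Iic, le_min_iff]
  tauto

theorem stopAll_mem_GamStar (hK : K ∈ GamStar S) (r : ℝ≥0) : SSEP.stopAll r K ∈ GamStar S := by
  rw [mem_GamStar_iff] at hK ⊢
  refine ⟨stopAll_mem_Gam hK.1 r, fun x t => ?_⟩
  obtain ⟨y, hy⟩ := hK.2 x (min t r)
  exact ⟨y, output_stopAll hy⟩

/-- If the algorithm stops then so does the algorithm for the increments after time `r`, whose jump
times are those after `r`, shifted by `r`. -/
theorem Output.exists_incAll (hK : K ∈ Gam S) {r : ℝ≥0} {x y : S} {I : Set ℝ≥0}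
    (h : Output K x I y) : ∃ y', Output (incAll r K) x {u | r + u ∈ I} y' := by
  induction h with
  | halt x I hI =>
    refine ⟨x, Output.halt x _ (eq_empty_iff_forall_notMem.2 fun u hu => ?_)⟩
    have := (mem_siteJumps_incAll hK).1 hu.2
    exact (hI ▸ (show r + u ∈ I ∩ siteJumps K x from ⟨hu.1, this.2⟩) : r + u ∈ (∅ : Set ℝ≥0))
  | move x z y I s hs hz hj h ih =>
    rcases le_or_gt s r with hsr | hsr
    · refine ⟨x, Output.halt x _ (eq_empty_iff_forall_notMem.2 fun u hu => ?_)⟩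
      have := (mem_siteJumps_incAll hK).1 hu.2
      have h1 := hs.2 ⟨hu.1, this.2⟩
      have h2 : r < r + u := lt_add_of_pos_right r this.1
      exact absurd (h2.trans_le h1) hsr.not_gt
    · obtain ⟨y', hy'⟩ := ih
      have hrs : r + (s - r) = s := add_tsub_cancel_of_le hsr.le
      have h0 : 0 < s - r := tsub_pos_of_lt hsr
      refine ⟨y', Output.move x z y' _ (s - r) ⟨⟨?_, ?_⟩, ?_⟩ hz ?_ ?_⟩
      · simpa only [Set.mem_ofPred_eq, hrs] using hs.1.1
      · exact (mem_siteJumps_incAll hK).2 ⟨h0, hrs.symm ▸ hs.1.2⟩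
      · intro u hu
        exact le_tsub_of_add_le_left (hs.2 ⟨hu.1, ((mem_siteJumps_incAll hK).1 hu.2).2⟩)
      · exact (hK.2.1 _).isJumpTime_incPath.2 ⟨h0, hrs.symm ▸ hj⟩
      · convert hy' using 1
        ext u
        simp [lt_tsub_iff_left]

theorem incAll_mem_GamStar (hK : K ∈ GamStar S) (r : ℝ≥0) : incAll r K ∈ GamStar S := by
  rw [mem_GamStar_iff] at hK ⊢
  refine ⟨incAll_mem_Gam hK.1 r, fun x t => ?_⟩
  obtain ⟨y, hy⟩ := hK.2 x (r + t)
  obtain ⟨y', hy'⟩ := hy.exists_incAll hK.1 (r := r)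
  exact ⟨y', by simpa [Iic] using hy'⟩

/-- The flow property: running the algorithm backwards over a window of the shifted paths, and then
over `[0, r]`, amounts to running it over the joint window. -/
theorem Output.flow (hK : K ∈ Gam S) {r : ℝ≥0} {x y w : S} {J : Set ℝ≥0}
    (h : Output (incAll r K) x J y) (h' : Output K y (Iic r) w) :
    Output K x {u | u ≤ r ∨ u - r ∈ J} w := by
  have hmem : ∀ {x : S} {J : Set ℝ≥0} {u : ℝ≥0}, r < u → u ∈ siteJumps K x → u - r ∈ J →
      u - r ∈ J ∩ siteJumps (incAll r K) x := fun {x J u} hr hu hJ =>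
    ⟨hJ, (mem_siteJumps_incAll hK).2 ⟨tsub_pos_of_lt hr, by rwa [add_tsub_cancel_of_le hr.le]⟩⟩
  induction h with
  | halt x J hJ =>
    refine h'.congr ?_
    ext u
    refine and_congr_left fun hu => ⟨Or.inl, ?_⟩
    rintro (h1 | h1)
    · exact h1
    · by_contra hc
      exact (hJ ▸ hmem (not_le.1 hc) hu h1 : u - r ∈ (∅ : Set ℝ≥0))
  | move x z y J s hs hz hj h ih =>
    have h0 := pos_of_mem_siteJumps hs.1.2
    refine Output.move x z w _ (r + s) ⟨⟨Or.inr ?_, ?_⟩, ?_⟩ hz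
      ((hK.2.1 _).isJumpTime_incPath.1 hj).2 ?_
    · rw [add_tsub_cancel_left]; exact hs.1.1
    · exact ((mem_siteJumps_incAll hK).1 hs.1.2).2
    · rintro u ⟨h1, hu⟩
      by_cases hr : u ≤ r
      · exact hr.trans le_self_add
      · exact tsub_le_iff_left.1 (hs.2 (hmem (not_le.1 hr) hu (h1.resolve_left hr)))
    · convert ih h' using 1
      ext u
      simp only [mem_Iio, Set.mem_ofPred_eq]
      constructor
      · intro hu
        by_cases hr : u ≤ r
        · exact Or.inl hr
        · exact Or.inr ((tsub_lt_iff_left (not_le.1 hr).le).2 hu)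
      · rintro (hu | hu)
        · exact hu.trans_lt (lt_add_of_pos_right r h0)
        · exact lt_add_of_tsub_lt_left hu

theorem stirX_flow (hK : K ∈ GamStar S) (r t : ℝ≥0) (x : S) :
    stirX K (r + t) x = (stirX (incAll r K) t x).bind (stirX K r) := by
  have h1 := mem_GamStar_iff.1 hK
  have h2 := mem_GamStar_iff.1 (incAll_mem_GamStar hK r)
  obtain ⟨y, hy⟩ := h2.2 x t
  obtain ⟨w, hw⟩ := h1.2 y r
  rw [(stirX_eq_some_iff h2.1).2 hy, Option.bind_some, (stirX_eq_some_iff h1.1).2 hw,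
    stirX_eq_some_iff h1.1]
  convert hy.flow h1.1 hw using 1
  ext u
  simp only [mem_Iic, Set.mem_ofPred_eq, tsub_le_iff_left]
  exact ⟨Or.inr, fun h => h.elim (fun h => h.trans le_self_add) id⟩

theorem eta_flow (hK : K ∈ GamStar S) (σ : S → Bool) (r t : ℝ≥0) :
    eta σ K (r + t) = eta (eta σ K r) (incAll r K) t := by
  funext x
  have h2 := mem_GamStar_iff.1 (incAll_mem_GamStar hK r)
  obtain ⟨y, hy⟩ := h2.2 x t
  simp only [eta, stirX_flow hK, (stirX_eq_some_iff h2.1).2 hy, Option.bind_some, Option.elim_some]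

theorem eta_stopAll (hK : K ∈ GamStar S) (σ : S → Bool) {r t : ℝ≥0} (ht : t ≤ r) :
    eta σ (SSEP.stopAll r K) t = eta σ K t := by
  funext x
  have h1 := mem_GamStar_iff.1 hK
  have h2 := mem_GamStar_iff.1 (stopAll_mem_GamStar hK r)
  obtain ⟨y, hy⟩ := h1.2 x t
  have hy' : Output (SSEP.stopAll r K) x (Iic t) y := output_stopAll (by rwa [min_eq_left ht])
  simp only [eta, (stirX_eq_some_iff h1.1).2 hy, (stirX_eq_some_iff h2.1).2 hy']

end SSEP

namespace SSEP

variable {S : Type*} {K : Edge S → CadlagPath ℕ}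

/-! ### Discretisation of the backward algorithm -/

/-- The path of `{x, z}` grows over `(a, b]`, and no path at `x` grows over `(b, t]`. -/
def JumpBetween (K : Edge S → CadlagPath ℕ) (x z : S) (a b t : ℝ≥0) : Prop :=
  (∀ y, ∀ h : x ≠ y, (K (edge x y h)).1 t ≤ (K (edge x y h)).1 b) ∧
    ∃ h : x ≠ z, (K (edge x z h)).1 a < (K (edge x z h)).1 b

/-- One step of the backward algorithm from `(x, t)`, discretised over the meshes `t / (m + 1)`:
for all large `m`, with `h = t / (m + 1)`, the last jump at `x` up to time `t` takes place in a cell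
`(k h, (k + 1) h]` and leads to a site `z` such that `K ∈ A z (k h)`. In contrast to the last jump
time itself, this is expressed by the values of the paths at countably many fixed times. -/
def stepSet (A : S → ℝ≥0 → Set (Edge S → CadlagPath ℕ)) (x : S) (t : ℝ≥0) :
    Set (Edge S → CadlagPath ℕ) :=
  {K | ∀ᶠ m : ℕ in atTop, ∃ k ≤ m, ∃ z,
    JumpBetween K x z (k * (t / (m + 1))) ((k + 1 : ℕ) * (t / (m + 1))) t ∧
      K ∈ A z (k * (t / (m + 1)))}

theorem exists_mem_siteJumps (hK : K ∈ Gam S) {x y : S} (h : x ≠ y) {a b : ℝ≥0}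
    (hlt : (K (edge x y h)).1 a < (K (edge x y h)).1 b) :
    ∃ s ∈ Ioc a b, IsJumpTime (K (edge x y h)) s := by
  have hab : a ≤ b := by
    by_contra! hc
    exact hlt.not_ge ((hK.2.1 _).monotone hc.le)
  exact exists_isJumpTime hab hlt.ne

/-- On a fine mesh, the discretised step finds the actual step of the algorithm and nothing else:
the cell of the last jump time `s` at `x` is the only one that qualifies, and from its left endpoint
the algorithm at `z` sees the same jump times as in the window `[0, s)`. -/
theorem eventually_jumpBetween (hK : K ∈ Gam S) {x z : S} {t s : ℝ≥0}
    (hs : IsGreatest (Iic t ∩ siteJumps K x) s) {hz : x ≠ z}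
    (hj : IsJumpTime (K (edge x z hz)) s) :
    ∀ᶠ m : ℕ in atTop, ∃ k ≤ m,
      JumpBetween K x z (k * (t / (m + 1))) ((k + 1 : ℕ) * (t / (m + 1))) t ∧
      Iic ((k : ℝ≥0) * (t / (m + 1))) ∩ siteJumps K z = Iio s ∩ siteJumps K z ∧
      ∀ k' ≤ m, ∀ z', JumpBetween K x z' (k' * (t / (m + 1))) ((k' + 1 : ℕ) * (t / (m + 1))) t →
        k' = k ∧ z' = z := by
  have h0 := pos_of_mem_siteJumps hs.1.2
  have hst : s ≤ t := hs.1.1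
  obtain ⟨u, hu, hu'⟩ := exists_no_jump_left hK x h0
  obtain ⟨v, hv, hv'⟩ := exists_no_jump_left hK z h0
  have e : ∀ᶠ m : ℕ in atTop, t / (m + 1 : ℝ≥0) < s - max u v :=
    (tendsto_mesh t).eventually (gt_mem_nhds (tsub_pos_of_lt (max_lt hu hv)))
  filter_upwards [e] with m hm
  obtain ⟨k, hk, hk1, hk2⟩ := exists_mesh_cell h0 hst m
  have hsucc : ∀ k : ℕ, ((k + 1 : ℕ) : ℝ≥0) * (t / (m + 1)) =
      k * (t / (m + 1)) + t / (m + 1) := fun k => by push_cast; ring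
  have hmax : max u v < k * (t / (m + 1)) := by
    rw [lt_tsub_iff_left] at hm
    rw [hsucc] at hk2
    by_contra! hc
    exact hm.not_ge (hk2.trans (by gcongr))
  refine ⟨k, hk, ⟨fun y hy => ?_, hz, ?_⟩, ?_, ?_⟩
  · by_contra! hc
    obtain ⟨s', hs', hj'⟩ := exists_mem_siteJumps hK hy hc
    have := hs.2 ⟨hs'.2, jump_mem_siteJumps hj'⟩
    exact (hk2.trans_lt hs'.1).not_ge this
  · exact (((hK.2.1 _).isJumpTime_iff.1 hj).2 _ hk1).trans_le ((hK.2.1 _).monotone hk2)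
  · ext r
    refine and_congr_left fun hr => ⟨fun h => lt_of_le_of_lt h hk1, fun h => ?_⟩
    exact ((hv' r hr h).trans ((le_max_right _ _).trans_lt hmax)).le
  · rintro k' hk' z' ⟨h1, hz', h2⟩
    obtain ⟨s', hs', hj'⟩ := exists_mem_siteJumps hK hz' h2
    have hs's : s' ≤ s := hs.2 ⟨hs'.2.trans (mesh_le hk'), jump_mem_siteJumps hj'⟩
    have hs2 : s ≤ (k' + 1 : ℕ) * (t / (m + 1)) := by
      by_contra! hc
      exact (((hK.2.1 _).isJumpTime_iff.1 hj).2 _ hc).not_ge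
        (((hK.2.1 _).monotone hst).trans (h1 z hz))
    have hkk : k' = k := by
      refine le_antisymm ?_ ?_
      · by_contra! hc
        have : ((k + 1 : ℕ) : ℝ≥0) * (t / (m + 1)) ≤ k' * (t / (m + 1)) := by
          gcongr; exact hc
        exact (hk2.trans this).not_gt (hs'.1.trans_le hs's)
      · by_contra! hc
        have : ((k' + 1 : ℕ) : ℝ≥0) * (t / (m + 1)) ≤ k * (t / (m + 1)) := by
          gcongr; exact hc
        exact (hs2.trans this).not_gt hk1
    subst hkk
    refine ⟨rfl, ?_⟩
    rcases hs's.eq_or_lt with rfl | hlt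
    · exact jump_unique hK hj' hj
    · have := hu' s' (jump_mem_siteJumps hj') hlt
      exact absurd hs'.1 ((this.trans ((le_max_left _ _).trans_lt hmax)).not_gt)

theorem mem_stepSet (hK : K ∈ Gam S) {x z : S} {t s : ℝ≥0}
    (hs : IsGreatest (Iic t ∩ siteJumps K x) s) {hz : x ≠ z}
    (hj : IsJumpTime (K (edge x z hz)) s) {A : S → ℝ≥0 → Set (Edge S → CadlagPath ℕ)}
    (hA : ∀ r, Iic r ∩ siteJumps K z = Iio s ∩ siteJumps K z → K ∈ A z r) :
    K ∈ stepSet A x t := by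
  refine (eventually_jumpBetween hK hs hj).mono ?_
  rintro m ⟨k, hk, h1, h2, -⟩
  exact ⟨k, hk, z, h1, hA _ h2⟩

theorem exists_of_mem_stepSet (hK : K ∈ Gam S) {x : S} {t : ℝ≥0}
    {A : S → ℝ≥0 → Set (Edge S → CadlagPath ℕ)} (h : K ∈ stepSet A x t) :
    ∃ z s, ∃ hz : x ≠ z, IsGreatest (Iic t ∩ siteJumps K x) s ∧
      IsJumpTime (K (edge x z hz)) s ∧
      ∃ r, Iic r ∩ siteJumps K z = Iio s ∩ siteJumps K z ∧ K ∈ A z r := by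
  have hne : (Iic t ∩ siteJumps K x).Nonempty := by
    obtain ⟨m, k, hk, z, ⟨-, hz, h2⟩, -⟩ := h.exists
    obtain ⟨s, hs, hj⟩ := exists_mem_siteJumps hK hz h2
    exact ⟨s, hs.2.trans (mesh_le hk), jump_mem_siteJumps hj⟩
  obtain ⟨s, hs⟩ := exists_isGreatest hK subset_rfl hne
  obtain ⟨z, hz, hj⟩ := hs.1.2
  obtain ⟨m, ⟨k, hk, z', h1, h2⟩, k', -, -, h3, h4⟩ :=
    (h.and (eventually_jumpBetween hK hs hj)).exists
  obtain ⟨rfl, rfl⟩ := h4 k hk z' h1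
  exact ⟨z', s, hz, hs, hj, _, h3, h2⟩

/-- The discretised event that the backward algorithm from `(x, t)` makes at least `n` moves. -/
def survive : ℕ → S → ℝ≥0 → Set (Edge S → CadlagPath ℕ)
  | 0 => fun _ _ => univ
  | n + 1 => stepSet (survive n)

/-- The event that the backward algorithm from `(x, t)` stops immediately with output `y`. -/
def haltSet (y x : S) (t : ℝ≥0) : Set (Edge S → CadlagPath ℕ) :=
  {K | x = y ∧ ∀ z, ∀ h : x ≠ z, (K (edge x z h)).1 t ≤ (K (edge x z h)).1 0}

/-- The discretised event that the backward algorithm from `(x, t)` stops after at most `n` moves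
with output `y`. -/
def outputSet (y : S) : ℕ → S → ℝ≥0 → Set (Edge S → CadlagPath ℕ)
  | 0 => haltSet y
  | n + 1 => fun x t => haltSet y x t ∪ stepSet (outputSet y n) x t

/-- An algorithm that does not stop makes at least `n` moves for all `n`. -/
theorem mem_survive (hK : K ∈ Gam S) (n : ℕ) :
    ∀ {x : S} {t : ℝ≥0}, (¬ ∃ y, Output K x (Iic t) y) → K ∈ survive n x t := by
  induction n with
  | zero => exact fun _ => mem_univ _
  | succ n ih =>
    intro x t h
    have hne : (Iic t ∩ siteJumps K x).Nonempty := by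
      by_contra hc
      exact h ⟨x, Output.halt x _ (not_nonempty_iff_eq_empty.1 hc)⟩
    obtain ⟨s, hs⟩ := exists_isGreatest hK subset_rfl hne
    obtain ⟨z, hz, hj⟩ := hs.1.2
    refine mem_stepSet hK hs hj fun r hr => ih ?_
    rintro ⟨y, hy⟩
    exact h ⟨y, Output.move x z y _ s hs hz hj (hy.congr hr)⟩

theorem mem_haltSet_iff (hK : K ∈ Gam S) {x y : S} {t : ℝ≥0} :
    K ∈ haltSet y x t ↔ x = y ∧ Iic t ∩ siteJumps K x = ∅ := by
  refine and_congr_right fun _ => ⟨fun h => ?_, fun h z hz => ?_⟩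
  · refine eq_empty_iff_forall_notMem.2 ?_
    rintro s ⟨hst, z, hz, hj⟩
    have h1 := ((hK.2.1 _).isJumpTime_iff.1 hj)
    exact (h1.2 0 h1.1).not_ge (((hK.2.1 _).monotone hst).trans (h z hz))
  · by_contra! hc
    obtain ⟨s, hs, hj⟩ := exists_mem_siteJumps hK hz hc
    exact (h ▸ (show s ∈ Iic t ∩ siteJumps K x from ⟨hs.2, jump_mem_siteJumps hj⟩) :
      s ∈ (∅ : Set ℝ≥0))

theorem output_iff_exists_mem_outputSet (hK : K ∈ Gam S) {x y : S} {t : ℝ≥0} :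
    Output K x (Iic t) y ↔ ∃ n, K ∈ outputSet y n x t := by
  constructor
  · intro h
    suffices ∃ n, ∀ t', Iic t' ∩ siteJumps K x = Iic t ∩ siteJumps K x →
        K ∈ outputSet y n x t' by
      obtain ⟨n, hn⟩ := this
      exact ⟨n, hn t rfl⟩
    generalize Iic t = I at h
    induction h with
    | halt x I hI => exact ⟨0, fun t' ht => (mem_haltSet_iff hK).2 ⟨rfl, ht.trans hI⟩⟩
    | move x z y I s hs hz hj h ih =>
      obtain ⟨n, hn⟩ := ih
      exact ⟨n + 1, fun t' ht => Or.inr (mem_stepSet hK (ht ▸ hs) hj hn)⟩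
  · rintro ⟨n, hn⟩
    induction n generalizing x t with
    | zero =>
      obtain ⟨rfl, h⟩ := (mem_haltSet_iff hK).1 hn
      exact Output.halt x _ h
    | succ n ih =>
      rcases hn with hn | hn
      · obtain ⟨rfl, h⟩ := (mem_haltSet_iff hK).1 hn
        exact Output.halt x _ h
      · obtain ⟨z, s, hz, hs, hj, r, hr, hA⟩ := exists_of_mem_stepSet hK hn
        exact Output.move x z y _ s hs hz hj ((ih hA).congr hr)

/-- The event of surviving `n` moves from `(x, t)` only involves the paths up to time `t`. -/
theorem survive_congr (n : ℕ) {K K' : Edge S → CadlagPath ℕ} {r : ℝ≥0}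
    (h : ∀ e, ∀ s ≤ r, (K e).1 s = (K' e).1 s) (x : S) {t : ℝ≥0} (ht : t ≤ r) :
    K ∈ survive n x t ↔ K' ∈ survive n x t := by
  induction n generalizing x t with
  | zero => exact iff_of_true (mem_univ _) (mem_univ _)
  | succ n ih =>
    refine eventually_congr (Eventually.of_forall fun m => exists_congr fun k =>
      and_congr_right fun hk => exists_congr fun z => ?_)
    have h1 : ((k + 1 : ℕ) : ℝ≥0) * (t / (m + 1)) ≤ r := (mesh_le hk).trans ht
    have h2 : (k : ℝ≥0) * (t / (m + 1)) ≤ r := le_trans (by gcongr; omega) h1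
    refine and_congr ?_ (ih z h2)
    unfold JumpBetween
    refine and_congr (forall₂_congr fun y hy => ?_) (exists_congr fun hz => ?_)
    · rw [h _ _ ht, h _ _ h1]
    · rw [h _ _ h2, h _ _ h1]

theorem stopAll_mem_survive_iff (n : ℕ) (x : S) {t r : ℝ≥0} (ht : t ≤ r) :
    stopAll r K ∈ survive n x t ↔ K ∈ survive n x t :=
  survive_congr n (fun e s hs => by simp [stopAll, stopPath, hs]) x ht

theorem measurable_eval (e : Edge S) (t : ℝ≥0) :
    Measurable fun K : Edge S → CadlagPath ℕ => (K e).1 t :=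
  (measurable_eval_path t).comp (measurable_pi_apply e)

/-- The `m`-th approximation of `stepSet A x t`. -/
def stepApprox (A : S → ℝ≥0 → Set (Edge S → CadlagPath ℕ)) (x : S) (t : ℝ≥0) (m : ℕ) :
    Set (Edge S → CadlagPath ℕ) :=
  ⋃ k ∈ Finset.range (m + 1), ⋃ z,
    {K | JumpBetween K x z (k * (t / (m + 1))) ((k + 1 : ℕ) * (t / (m + 1))) t} ∩
      A z (k * (t / (m + 1)))

theorem mem_stepApprox {A : S → ℝ≥0 → Set (Edge S → CadlagPath ℕ)} {x : S} {t : ℝ≥0} {m : ℕ} :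
    K ∈ stepApprox A x t m ↔ ∃ k ≤ m, ∃ z,
      JumpBetween K x z (k * (t / (m + 1))) ((k + 1 : ℕ) * (t / (m + 1))) t ∧
        K ∈ A z (k * (t / (m + 1))) := by
  simp [stepApprox]

theorem stepSet_eq (A : S → ℝ≥0 → Set (Edge S → CadlagPath ℕ)) (x : S) (t : ℝ≥0) :
    stepSet A x t = ⋃ N, ⋂ m, ⋂ (_ : N ≤ m), stepApprox A x t m := by
  ext K
  simp only [stepSet, Set.mem_ofPred_eq, eventually_atTop, mem_iUnion, mem_iInter, mem_stepApprox]

theorem measurableSet_exists_lt (x z : S) (a b : ℝ≥0) :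
    MeasurableSet {K : Edge S → CadlagPath ℕ |
      ∃ h : x ≠ z, (K (edge x z h)).1 a < (K (edge x z h)).1 b} := by
  simp only [ofPred_exists]
  exact MeasurableSet.iUnion fun h =>
    measurableSet_lt (measurable_eval _ _) (measurable_eval _ _)

section Measurability

variable [Countable S]

theorem measurableSet_forall_le (x : S) (a b : ℝ≥0) :
    MeasurableSet {K : Edge S → CadlagPath ℕ |
      ∀ y, ∀ h : x ≠ y, (K (edge x y h)).1 a ≤ (K (edge x y h)).1 b} := by
  simp only [ofPred_forall]
  exact MeasurableSet.iInter fun y => MeasurableSet.iInter fun h =>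
    measurableSet_le (measurable_eval _ _) (measurable_eval _ _)

theorem measurableSet_jumpBetween (x z : S) (a b t : ℝ≥0) :
    MeasurableSet {K : Edge S → CadlagPath ℕ | JumpBetween K x z a b t} :=
  (measurableSet_forall_le x t b).inter (measurableSet_exists_lt x z a b)

theorem measurableSet_stepApprox {A : S → ℝ≥0 → Set (Edge S → CadlagPath ℕ)}
    (hA : ∀ z r, MeasurableSet (A z r)) (x : S) (t : ℝ≥0) (m : ℕ) :
    MeasurableSet (stepApprox A x t m) :=
  Finset.measurableSet_biUnion _ fun _ _ => MeasurableSet.iUnion fun z =>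
    (measurableSet_jumpBetween x z _ _ _).inter (hA _ _)

theorem measurableSet_stepSet {A : S → ℝ≥0 → Set (Edge S → CadlagPath ℕ)}
    (hA : ∀ z r, MeasurableSet (A z r)) (x : S) (t : ℝ≥0) : MeasurableSet (stepSet A x t) := by
  rw [stepSet_eq]
  exact MeasurableSet.iUnion fun N => MeasurableSet.iInter fun m => MeasurableSet.iInter fun _ =>
    measurableSet_stepApprox hA x t m

theorem measurableSet_survive (n : ℕ) (x : S) (t : ℝ≥0) : MeasurableSet (survive n x t) := by
  induction n generalizing x t with
  | zero => exact MeasurableSet.univ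
  | succ n ih => exact measurableSet_stepSet ih x t

theorem measurableSet_outputSet (y : S) (n : ℕ) (x : S) (t : ℝ≥0) :
    MeasurableSet (outputSet y n x t) := by
  have h0 : ∀ x t, MeasurableSet (haltSet y x t) := fun x t =>
    (MeasurableSet.const (x = y)).inter (measurableSet_forall_le x t 0)
  induction n generalizing x t with
  | zero => exact h0 x t
  | succ n ih => exact (h0 x t).union (measurableSet_stepSet ih x t)

theorem measurableSet_output (x y : S) (t : ℝ≥0) :
    MeasurableSet {K | K ∈ Gam S ∧ Output K x (Iic t) y} := by
  have : {K | K ∈ Gam S ∧ Output K x (Iic t) y} = Gam S ∩ ⋃ n, outputSet y n x t := by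
    ext K
    refine and_congr_right fun hK => ?_
    rw [output_iff_exists_mem_outputSet hK, mem_iUnion]
  rw [this]
  exact measurableSet_Gam.inter (MeasurableSet.iUnion fun n => measurableSet_outputSet y n x t)

theorem measurableSet_GamStar : MeasurableSet (GamStar S) := by
  have : GamStar S = Gam S ∩
      ⋂ x, ⋂ q : ℚ≥0, ⋃ y, {K | K ∈ Gam S ∧ Output K x (Iic (q : ℝ≥0)) y} := by
    ext K
    simp only [mem_inter_iff, mem_iInter, mem_iUnion, Set.mem_ofPred_eq]
    constructor
    · intro h
      have h' := mem_GamStar_iff.1 h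
      exact ⟨h'.1, fun x q => (h'.2 x q).imp fun y hy => ⟨h'.1, hy⟩⟩
    · rintro ⟨h1, h2⟩
      exact mem_GamStar_of_rat h1 fun x q => (h2 x q).imp fun y hy => hy.2
  rw [this]
  exact measurableSet_Gam.inter (MeasurableSet.iInter fun x => MeasurableSet.iInter fun q =>
    MeasurableSet.iUnion fun y => measurableSet_output x y q)

/-- The path `η^σ_·[𝒦]` depends measurably on the pair `(σ, 𝒦)`. -/
theorem measurable_etaPath_prod :
    Measurable fun p : (S → Bool) × GamStar S => etaPath p.1 p.2.1 := by
  have he : (fun p : (S → Bool) × GamStar S => etaPath p.1 p.2.1) =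
      fun p => ⟨eta p.1 p.2.1, isCadlag_eta p.2.2 p.1⟩ := by
    funext p
    rw [etaPath, dif_pos (isCadlag_eta p.2.2 p.1)]
  rw [he]
  refine Measurable.subtype_mk (measurable_pi_lambda _ fun t => measurable_pi_lambda _ fun x => ?_)
  refine measurable_to_bool ?_
  have : (fun p : (S → Bool) × GamStar S => eta p.1 p.2.1 t x) ⁻¹' {true} =
      ⋃ y, ((fun p => p.1 y) ⁻¹' {true}) ∩
        ((fun p => p.2.1) ⁻¹' {K | K ∈ Gam S ∧ Output K x (Iic t) y}) := by
    ext ⟨σ, K, hK⟩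
    have hG := (mem_GamStar_iff.1 hK).1
    obtain ⟨y, hy⟩ := (mem_GamStar_iff.1 hK).2 x t
    simp only [mem_preimage, mem_singleton_iff, mem_iUnion, mem_inter_iff, Set.mem_ofPred_eq, eta,
      (stirX_eq_some_iff hG).2 hy, Option.elim_some]
    constructor
    · exact fun h => ⟨y, h, hG, hy⟩
    · rintro ⟨y', h, -, hy'⟩
      rwa [hy.unique hG hy']
  rw [this]
  refine MeasurableSet.iUnion fun y => MeasurableSet.inter ?_ ?_
  · exact ((measurable_pi_apply y).comp measurable_fst) (measurableSet_singleton true)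
  · exact (measurable_subtype_coe.comp measurable_snd) (measurableSet_output x y t)

end Measurability

end SSEP

namespace SSEP

variable {S : Type*}

/-! ### Poisson processes: law, independence of past and future -/

theorem poissonMeasure_ne_zero_le (r : ℝ≥0) : poissonMeasure r {n | n ≠ 0} ≤ r := by
  have h : {n : ℕ | n ≠ 0} = {0}ᶜ := rfl
  rw [h, prob_compl_eq_one_sub (measurableSet_singleton 0), poissonMeasure_singleton,
    tsub_le_iff_right]
  rw [← ENNReal.ofReal_coe_nnreal, ← ENNReal.ofReal_add (by positivity) (by positivity),
    ← ENNReal.ofReal_one]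
  refine ENNReal.ofReal_le_ofReal ?_
  have := Real.one_sub_le_exp_neg (r : ℝ)
  simp only [pow_zero, Nat.factorial_zero, Nat.cast_one]
  linarith

theorem poissonMeasure_two_le (r : ℝ≥0) : poissonMeasure r {n | 2 ≤ n} ≤ (r : ℝ≥0∞) ^ 2 := by
  have h : {n : ℕ | 2 ≤ n} = ({0} ∪ {1})ᶜ := by
    ext n
    simp only [Set.mem_ofPred_eq, mem_compl_iff, mem_union, mem_singleton_iff]
    omega
  rw [h, prob_compl_eq_one_sub ((measurableSet_singleton 0).union (measurableSet_singleton 1)),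
    measure_union (by simp) (measurableSet_singleton 1), poissonMeasure_singleton,
    poissonMeasure_singleton, tsub_le_iff_right, ← ENNReal.ofReal_coe_nnreal,
    ← ENNReal.ofReal_pow (by positivity), ← ENNReal.ofReal_add (by positivity) (by positivity),
    ← ENNReal.ofReal_add (by positivity) (by positivity), ← ENNReal.ofReal_one]
  refine ENNReal.ofReal_le_ofReal ?_
  have := Real.one_sub_le_exp_neg (r : ℝ)
  have h0 : (0 : ℝ) ≤ r := r.2
  simp only [pow_zero, Nat.factorial_zero, Nat.cast_one, pow_one, Nat.factorial_one]
  nlinarith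

/-- A finite set of times is covered by a nondecreasing sequence of times starting from `0`. -/
theorem exists_monotone_seq (F : Finset ℝ≥0) :
    ∃ τ : ℕ → ℝ≥0, Monotone τ ∧ τ 0 = 0 ∧ ∀ t ∈ F, ∃ i, τ i = t := by
  classical
  let G := insert 0 F
  have hG : 0 < G.card := Finset.card_pos.2 ⟨0, Finset.mem_insert_self _ _⟩
  let τ : ℕ → ℝ≥0 := fun i => G.orderEmbOfFin rfl ⟨min i (G.card - 1), by omega⟩
  have hτ : Monotone τ := fun i j hij =>
    (G.orderEmbOfFin rfl).monotone (Fin.mk_le_mk.2 (min_le_min_right _ hij))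
  have hr : ∀ t ∈ G, ∃ i, τ i = t := by
    intro t ht
    have : t ∈ range (G.orderEmbOfFin rfl) := by rwa [Finset.range_orderEmbOfFin]
    obtain ⟨i, hi⟩ := this
    refine ⟨i, ?_⟩
    have : min (i : ℕ) (G.card - 1) = i := min_eq_left (by omega)
    simp only [τ, this]
    exact hi
  refine ⟨τ, hτ, ?_, fun t ht => hr t (Finset.mem_insert_of_mem ht)⟩
  obtain ⟨i, hi⟩ := hr 0 (Finset.mem_insert_self _ _)
  exact le_antisymm (hi ▸ hτ (Nat.zero_le i)) zero_le

section Poisson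

variable {Ω : Type*} [MeasurableSpace Ω] {Q : Measure Ω} {r : ℝ≥0} {N : Ω → CadlagPath ℕ}

theorem IsPoissonProcess.measurable_eval (hN : IsPoissonProcess r N Q) (t : ℝ≥0) :
    Measurable fun ω => (N ω).1 t :=
  (measurable_eval_path t).comp hN.measurable

/-- The value of a Poisson process at a time of a partition is the sum of its increments. -/
theorem IsPoissonProcess.ae_eq_sum (hN : IsPoissonProcess r N Q) {τ : ℕ → ℝ≥0} (hτ : Monotone τ)
    (h0 : τ 0 = 0) : ∀ᵐ ω ∂Q, ∀ n,
      (N ω).1 (τ n) = ∑ i ∈ Finset.range n, ((N ω).1 (τ (i + 1)) - (N ω).1 (τ i)) := by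
  filter_upwards [hN.zero, hN.monotone] with ω h1 h2 n
  rw [Finset.sum_range_tsub (f := fun i => (N ω).1 (τ i)) (h2.comp hτ) n, h0, h1, Nat.sub_zero]

theorem IsPoissonProcess.map_increments (hN : IsPoissonProcess r N Q) {τ : ℕ → ℝ≥0}
    (hτ : Monotone τ) :
    Q.map (fun ω i => (N ω).1 (τ (i + 1)) - (N ω).1 (τ i)) =
      Measure.infinitePi fun i => poissonMeasure (r * (τ (i + 1) - τ i)) := by
  have h := (hN.indep.nat hτ).map_fun_eq_infinitePi_map fun i =>
    (hN.measurable_eval (τ (i + 1))).sub (hN.measurable_eval (τ i))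
  refine h.trans ?_
  congr with i : 1
  exact (hN.increment _ _ (hτ (Nat.le_succ i))).map_eq

/-- The finite-dimensional marginals of a Poisson process are the laws of partial sums of
independent Poisson variables. -/
theorem IsPoissonProcess.map_restrict (hN : IsPoissonProcess r N Q) {τ : ℕ → ℝ≥0}
    (hτ : Monotone τ) (h0 : τ 0 = 0) (I : Finset ℝ≥0) (a : I → ℕ) (ha : ∀ s : I, τ (a s) = s) :
    Q.map (fun ω => I.restrict (N ω).1) =
      (Measure.infinitePi fun i => poissonMeasure (r * (τ (i + 1) - τ i))).map
        fun x s => ∑ i ∈ Finset.range (a s), x i := by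
  rw [← hN.map_increments hτ, Measure.map_map]
  · refine Measure.map_congr ?_
    filter_upwards [hN.ae_eq_sum hτ h0] with ω hω
    funext s
    simp only [Function.comp_apply, Finset.restrict]
    rw [← hω (a s), ha]
  · exact measurable_pi_lambda _ fun s =>
      Finset.measurable_fun_sum _ fun i _ => measurable_pi_apply i
  · exact measurable_pi_lambda _ fun i =>
      (hN.measurable_eval (τ (i + 1))).sub (hN.measurable_eval (τ i))

/-- A Poisson process is determined in law by its intensity. -/
theorem IsPoissonProcess.map_eq [IsProbabilityMeasure Q] (hN : IsPoissonProcess r N Q)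
    {Ω' : Type*} [MeasurableSpace Ω'] {Q' : Measure Ω'} [IsProbabilityMeasure Q']
    {N' : Ω' → CadlagPath ℕ} (hN' : IsPoissonProcess r N' Q') : Q.map N = Q'.map N' := by
  have key : Q.map (fun ω t => (N ω).1 t) = Q'.map (fun ω t => (N' ω).1 t) := by
    have h1 := isProjectiveLimit_map (P := Q) (X := fun t ω => (N ω).1 t)
      (measurable_subtype_coe.comp hN.measurable).aemeasurable
    have h2 := isProjectiveLimit_map (P := Q') (X := fun t ω => (N' ω).1 t)
      (measurable_subtype_coe.comp hN'.measurable).aemeasurable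
    refine h1.unique (fun I => (h2 I).trans ?_)
    obtain ⟨τ, hτ, h0, hI⟩ := exists_monotone_seq I
    choose a ha using fun s : I => hI s s.2
    exact (hN'.map_restrict hτ h0 I a ha).trans (hN.map_restrict hτ h0 I a ha).symm
  ext A hA
  obtain ⟨B, hB, rfl⟩ := hA
  have h1 : Q.map (Subtype.val ∘ N) B = Q'.map (Subtype.val ∘ N') B :=
    congrArg (fun μ => μ B) key
  rw [Measure.map_apply (measurable_subtype_coe.comp hN.measurable) hB,
    Measure.map_apply (measurable_subtype_coe.comp hN'.measurable) hB] at h1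
  rw [Measure.map_apply hN.measurable (measurable_subtype_coe hB),
    Measure.map_apply hN'.measurable (measurable_subtype_coe hB)]
  exact h1

theorem IsPoissonProcess.incPath (hN : IsPoissonProcess r N Q) (u : ℝ≥0) :
    IsPoissonProcess r (fun ω => incPath u (N ω)) Q where
  measurable := (measurable_incPath u).comp hN.measurable
  zero := Eventually.of_forall fun ω => by simp [SSEP.incPath]
  monotone := by
    filter_upwards [hN.monotone] with ω h s t hst
    exact Nat.sub_le_sub_right (h (by gcongr)) _
  indep := by
    intro n t ht
    have h := hN.indep n (fun i => u + t i) fun i j hij =>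
      add_le_add_right (ht hij) u
    refine h.congr fun i => ?_
    filter_upwards [hN.monotone] with ω hm
    have h1 := hm (le_self_add : u ≤ u + t i.castSucc)
    simp only [SSEP.incPath]
    omega
  increment := by
    intro s t hst
    have h := hN.increment (u + s) (u + t) (by gcongr)
    rw [add_tsub_add_eq_tsub_left] at h
    refine h.congr ?_
    filter_upwards [hN.monotone] with ω hm
    have h1 := hm (le_self_add : u ≤ u + s)
    simp only [SSEP.incPath]
    omega

/-- The path up to time `u` and the increments after time `u` of a Poisson process are independent:
at finitely many times, the former are sums of increments over cells of a partition before `u`, and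
the latter over cells after `u`. -/
theorem IsPoissonProcess.indepFun_stop_inc [IsProbabilityMeasure Q] (hN : IsPoissonProcess r N Q)
    (u : ℝ≥0) : IndepFun (fun ω => stopPath u (N ω)) (fun ω => SSEP.incPath u (N ω)) Q := by
  classical
  have key : IndepFun (fun ω t => (stopPath u (N ω)).1 t)
      (fun ω t => (SSEP.incPath u (N ω)).1 t) Q := by
    refine IndepFun.process_indepFun_process
      (X := fun t ω => (stopPath u (N ω)).1 t) (Y := fun t ω => (SSEP.incPath u (N ω)).1 t)
      (fun t => (measurable_eval_path t).comp ((measurable_stopPath u).comp hN.measurable))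
      (fun t => (measurable_eval_path t).comp ((measurable_incPath u).comp hN.measurable))
      fun I J => ?_
    obtain ⟨τ, hτ, h0, hF⟩ := exists_monotone_seq
      (I.image (min · u) ∪ ({u} ∪ J.image (u + ·)))
    obtain ⟨b, hb⟩ := hF u (by simp)
    choose a ha using fun s : I => hF (min s u)
      (Finset.mem_union_left _ (Finset.mem_image_of_mem _ s.2))
    choose d hd using fun s : J => hF (u + s)
      (Finset.mem_union_right _ (Finset.mem_union_right _ (Finset.mem_image_of_mem _ s.2)))
    let X : ℕ → Ω → ℕ := fun i ω => (N ω).1 (τ (i + 1)) - (N ω).1 (τ i)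
    have hXm : ∀ i, Measurable (X i) := fun i =>
      (hN.measurable_eval (τ (i + 1))).sub (hN.measurable_eval (τ i))
    have hX : iIndepFun X Q := hN.indep.nat hτ
    have hind := indep_iSup_of_disjoint (fun i => (hXm i).comap_le) hX.iIndep
      (S := Iio b) (T := Ici b) (Set.disjoint_left.2 fun i h1 h2 => (mem_Ici.1 h2).not_gt h1)
    have hle : ∀ (T : Set ℕ), ∀ i ∈ T,
        Measurable[⨆ i ∈ T, MeasurableSpace.comap (X i) inferInstance] (X i) := fun T i hi =>
      Measurable.mono (comap_measurable (X i))
        (le_iSup₂_of_le (f := fun i (_ : i ∈ T) => MeasurableSpace.comap (X i) inferInstance)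
          i hi le_rfl) le_rfl
    have h1 : IndepFun (fun ω (s : I) => ∑ i ∈ Finset.range (min (a s) b), X i ω)
        (fun ω (s : J) => ∑ i ∈ Finset.Ico b (max (d s) b), X i ω) Q := by
      rw [IndepFun_iff_Indep]
      refine indep_of_indep_of_le_right (indep_of_indep_of_le_left hind ?_) ?_
      · refine Measurable.comap_le ?_
        refine @measurable_pi_lambda _ _ _ (_) _ _ fun s => ?_
        exact @Finset.measurable_fun_sum _ _ _ _ _ _ (_) _ _ fun i hi =>
          hle _ i (by have := Finset.mem_range.1 hi; exact mem_Iio.2 (by omega))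
      · refine Measurable.comap_le ?_
        refine @measurable_pi_lambda _ _ _ (_) _ _ fun s => ?_
        exact @Finset.measurable_fun_sum _ _ _ _ _ _ (_) _ _ fun i hi =>
          hle _ i (Finset.mem_Ico.1 hi).1
    refine h1.congr ?_ ?_
    · filter_upwards [hN.ae_eq_sum hτ h0] with ω hω
      funext s
      rw [← hω, hτ.map_min, ha, hb]
      simp [stopPath]
    · filter_upwards [hN.ae_eq_sum hτ h0] with ω hω
      funext s
      have h2 := Finset.sum_range_add_sum_Ico (fun i => X i ω) (le_max_right (d s) b)
      have h3 : (N ω).1 (τ (max (d s) b)) = (N ω).1 (u + s) := by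
        rw [hτ.map_max, hd, hb, max_eq_left le_self_add]
      have h4 : (N ω).1 (τ b) = (N ω).1 u := by rw [hb]
      rw [hω] at h3 h4
      simp only [SSEP.incPath]
      rw [← h3, ← h4]
      exact Nat.eq_sub_of_add_eq' h2
  rw [IndepFun_iff_Indep] at key ⊢
  convert key using 1
  · exact MeasurableSpace.comap_comp
  · exact MeasurableSpace.comap_comp

end Poisson

theorem iIndepFun_bool {Ω β : Type*} [MeasurableSpace Ω] [MeasurableSpace β] {Q : Measure Ω}
    [IsProbabilityMeasure Q] {f : Bool → Ω → β} (hf : ∀ b, Measurable (f b))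
    (h : IndepFun (f false) (f true) Q) : iIndepFun f Q := by
  have (b : Bool) : IsProbabilityMeasure (Q.map (f b)) :=
    Measure.isProbabilityMeasure_map (hf b).aemeasurable
  rw [iIndepFun_iff_map_fun_eq_pi_map fun b => (hf b).aemeasurable]
  refine (Measure.pi_eq fun s hs => ?_).symm
  rw [Measure.map_apply (measurable_pi_lambda _ hf) (MeasurableSet.univ_pi hs), Fintype.prod_bool,
    Measure.map_apply (hf _) (hs _), Measure.map_apply (hf _) (hs _), mul_comm,
    ← h.measure_inter_preimage_eq_mul _ _ (hs _) (hs _)]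
  congr 1
  ext ω
  simp

/-- If the families `(X_i, Y_i)` are independent over `i`, and `X_i`, `Y_i` are independent for each
`i`, then the families `(X_i)_i` and `(Y_i)_i` are independent. -/
theorem indepFun_pi_of_iIndepFun {Ω ι α β : Type*} [MeasurableSpace Ω] [MeasurableSpace α]
    [MeasurableSpace β] {Q : Measure Ω} [IsProbabilityMeasure Q] {Z : ι → Ω → α}
    (hZ : iIndepFun Z Q) (hZm : ∀ i, Measurable (Z i)) {f g : α → β} (hf : Measurable f)
    (hg : Measurable g) (hfg : ∀ i, IndepFun (fun ω => f (Z i ω)) (fun ω => g (Z i ω)) Q) :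
    IndepFun (fun ω i => f (Z i ω)) (fun ω i => g (Z i ω)) Q := by
  let X : ι → Bool → Ω → β := fun i b ω => cond b (g (Z i ω)) (f (Z i ω))
  have hX : ∀ i b, Measurable (X i b) := by
    rintro i (_ | _)
    · exact hf.comp (hZm i)
    · exact hg.comp (hZm i)
  have h1 : iIndepFun (fun (p : ι × Bool) ω => X p.1 p.2 ω) Q := by
    refine iIndepFun_uncurry' hX ?_ fun i => iIndepFun_bool (hX i) (hfg i)
    refine hZ.comp (fun i a b => cond b (g a) (f a)) fun i => measurable_pi_lambda _ ?_
    rintro (_ | _)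
    · exact hf
    · exact hg
  have h2 := indep_iSup_of_disjoint (fun p : ι × Bool => (hX p.1 p.2).comap_le) h1.iIndep
    (S := {p | p.2 = false}) (T := {p | p.2 = true})
    (Set.disjoint_left.2 fun p h h' => by
      have h1 : p.2 = false := h
      have h2 : p.2 = true := h'
      simp [h1] at h2)
  have hle : ∀ (T : Set (ι × Bool)), ∀ p ∈ T,
      Measurable[⨆ p ∈ T, MeasurableSpace.comap (X p.1 p.2) inferInstance] (X p.1 p.2) :=
    fun T p hp => Measurable.mono (comap_measurable (X p.1 p.2))
      (le_iSup₂_of_le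
        (f := fun (p : ι × Bool) (_ : p ∈ T) => MeasurableSpace.comap (X p.1 p.2) inferInstance)
        p hp le_rfl) le_rfl
  rw [IndepFun_iff_Indep]
  refine indep_of_indep_of_le_right (indep_of_indep_of_le_left h2 ?_) ?_
  · refine Measurable.comap_le ?_
    exact @measurable_pi_lambda _ _ _ (_) _ _ fun i => hle _ (i, false) rfl
  · refine Measurable.comap_le ?_
    exact @measurable_pi_lambda _ _ _ (_) _ _ fun i => hle _ (i, true) rfl

end SSEP

namespace SSEP

variable {S : Type*}

/-! ### The law of the driving Poisson processes -/

/-- Fatou's lemma for events: the probability that `D m` takes place for all large `m` is at most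
the limit of bounds on the probabilities of `D m`. -/
theorem measure_iUnion_iInter_le {Ω : Type*} [MeasurableSpace Ω] {Q : Measure Ω} {D : ℕ → Set Ω}
    {a : ℕ → ℝ≥0∞} {b : ℝ≥0∞} (h : ∀ m, Q (D m) ≤ a m) (ha : Tendsto a atTop (𝓝 b)) :
    Q (⋃ N, ⋂ m, ⋂ (_ : N ≤ m), D m) ≤ b := by
  have hmono : Monotone fun N => ⋂ m, ⋂ (_ : N ≤ m), D m := fun N N' hN =>
    iInter_mono fun m => iInter_mono' fun hm => ⟨hN.trans hm, subset_rfl⟩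
  rw [hmono.measure_iUnion]
  refine iSup_le fun N => ge_of_tendsto ha ?_
  filter_upwards [eventually_ge_atTop N] with m hm
  exact (measure_mono (iInter₂_subset m hm)).trans (h m)

/-- A nondecreasing counting process has unit jumps a.s. if the probability of an increment of at
least `2` is quadratically small in the length of the time interval. -/
theorem ae_hasUnitJumps {Ω : Type*} [MeasurableSpace Ω] {Q : Measure Ω} {M : Ω → CadlagPath ℕ}
    (hmono : ∀ᵐ ω ∂Q, Monotone (M ω).1) (C : ℝ≥0)
    (hC : ∀ s t : ℝ≥0, s ≤ t →
      Q {ω | (M ω).1 s + 2 ≤ (M ω).1 t} ≤ ((C * (t - s) ^ 2 : ℝ≥0) : ℝ≥0∞)) :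
    ∀ᵐ ω ∂Q, HasUnitJumps (M ω) := by
  have key : ∀ T : ℕ, ∀ᵐ ω ∂Q, ∃ᶠ m in atTop, UnitOnMesh T m (M ω).1 := by
    intro T
    let D : ℕ → Set Ω := fun m => ⋃ k ∈ Finset.range (m + 1),
      {ω | (M ω).1 (k * ((T : ℝ≥0) / (m + 1))) + 2 ≤
        (M ω).1 ((k + 1 : ℕ) * ((T : ℝ≥0) / (m + 1)))}
    have hD : ∀ m, Q (D m) ≤ ((C * T * ((T : ℝ≥0) / (m + 1)) : ℝ≥0) : ℝ≥0∞) := by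
      intro m
      refine (measure_biUnion_finset_le _ _).trans ?_
      refine (Finset.sum_le_sum fun k _ => hC _ _ (by gcongr; omega)).trans ?_
      rw [← ENNReal.ofNNReal_finsetSum]
      refine ENNReal.coe_le_coe.2 (le_of_eq ?_)
      have : ∀ k : ℕ, ((k + 1 : ℕ) : ℝ≥0) * ((T : ℝ≥0) / (m + 1)) - k * ((T : ℝ≥0) / (m + 1)) =
          (T : ℝ≥0) / (m + 1) := fun k => by
        rw [← tsub_mul]; simp
      simp only [this, Finset.sum_const, Finset.card_range, nsmul_eq_mul]
      push_cast
      field_simp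
    have h0 : Q (⋃ N, ⋂ m, ⋂ (_ : N ≤ m), D m) = 0 := by
      refine le_antisymm (measure_iUnion_iInter_le hD ?_) zero_le
      rw [← ENNReal.coe_zero, ENNReal.tendsto_coe]
      simpa using (tendsto_mesh (T : ℝ≥0)).const_mul (C * T)
    filter_upwards [hmono, measure_eq_zero_iff_ae_notMem.1 h0] with ω h1 h2
    intro h3
    refine h2 ?_
    obtain ⟨N, hN⟩ := eventually_atTop.1 h3
    refine mem_iUnion.2 ⟨N, mem_iInter₂.2 fun m hm => ?_⟩
    have h4 := hN m hm
    unfold UnitOnMesh at h4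
    push Not at h4
    obtain ⟨k, hk, h5⟩ := h4
    have h6 := h5 (h1 (by gcongr; omega))
    exact mem_biUnion (Finset.mem_coe.2 (Finset.mem_range.2 (Nat.lt_succ_of_le hk))) h6
  filter_upwards [ae_all_iff.2 key] with ω h
  exact hasUnitJumps_of_frequently h

section

variable {Ω : Type*} [MeasurableSpace Ω] {Q : Measure Ω} {r r' : ℝ≥0} {N N' : Ω → CadlagPath ℕ}

theorem IsPoissonProcess.measure_inc_ne_zero_le (hN : IsPoissonProcess r N Q) {s t : ℝ≥0}
    (hst : s ≤ t) :
    Q {ω | (N ω).1 t - (N ω).1 s ≠ 0} ≤ ((r * (t - s) : ℝ≥0) : ℝ≥0∞) := by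
  rw [(hN.increment s t hst).measure_eq (p := fun n => n ≠ 0) (MeasurableSet.of_discrete)]
  exact poissonMeasure_ne_zero_le _

theorem IsPoissonProcess.measure_two_le_inc (hN : IsPoissonProcess r N Q) {s t : ℝ≥0}
    (hst : s ≤ t) :
    Q {ω | 2 ≤ (N ω).1 t - (N ω).1 s} ≤ ((r ^ 2 * (t - s) ^ 2 : ℝ≥0) : ℝ≥0∞) := by
  rw [(hN.increment s t hst).measure_eq (p := fun n => 2 ≤ n) (MeasurableSet.of_discrete)]
  refine (poissonMeasure_two_le _).trans (le_of_eq ?_)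
  push_cast
  ring

theorem IsPoissonProcess.ae_hasUnitJumps (hN : IsPoissonProcess r N Q) :
    ∀ᵐ ω ∂Q, HasUnitJumps (N ω) := by
  refine SSEP.ae_hasUnitJumps hN.monotone (r ^ 2) fun s t hst =>
    (measure_mono fun ω hω => ?_).trans (hN.measure_two_le_inc hst)
  simp only [Set.mem_ofPred_eq] at hω ⊢
  omega

/-- The sum of two independent Poisson processes has unit jumps, i.e. they have no common
jump time. -/
theorem IsPoissonProcess.ae_hasUnitJumps_add (hN : IsPoissonProcess r N Q)
    (hN' : IsPoissonProcess r' N' Q) (h : IndepFun N N' Q) :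
    ∀ᵐ ω ∂Q, HasUnitJumps (addPath (N ω) (N' ω)) := by
  refine SSEP.ae_hasUnitJumps (M := fun ω => addPath (N ω) (N' ω)) ?_
    (r ^ 2 + r' ^ 2 + r * r') fun s t hst => ?_
  · filter_upwards [hN.monotone, hN'.monotone] with ω h1 h2
    exact h1.add h2
  · have hsub : {ω | (addPath (N ω) (N' ω)).1 s + 2 ≤ (addPath (N ω) (N' ω)).1 t} ⊆
        {ω | 2 ≤ (N ω).1 t - (N ω).1 s} ∪ {ω | 2 ≤ (N' ω).1 t - (N' ω).1 s} ∪
          ({ω | (N ω).1 t - (N ω).1 s ≠ 0} ∩ {ω | (N' ω).1 t - (N' ω).1 s ≠ 0}) := by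
      intro ω hω
      simp only [addPath, Set.mem_ofPred_eq, mem_union, mem_inter_iff] at hω ⊢
      omega
    have hind : Q ({ω | (N ω).1 t - (N ω).1 s ≠ 0} ∩ {ω | (N' ω).1 t - (N' ω).1 s ≠ 0}) =
        Q {ω | (N ω).1 t - (N ω).1 s ≠ 0} * Q {ω | (N' ω).1 t - (N' ω).1 s ≠ 0} := by
      have hm : MeasurableSet {f : CadlagPath ℕ | f.1 t - f.1 s ≠ 0} :=
        ((measurable_eval_path t).sub (measurable_eval_path s)) (measurableSet_singleton 0).compl
      exact h.measure_inter_preimage_eq_mul _ _ hm hm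
    refine (measure_mono hsub).trans ((measure_union_le _ _).trans
      ((add_le_add_left (measure_union_le _ _) _).trans ?_))
    rw [hind]
    refine (add_le_add (add_le_add (hN.measure_two_le_inc hst) (hN'.measure_two_le_inc hst))
      (mul_le_mul' (hN.measure_inc_ne_zero_le hst) (hN'.measure_inc_ne_zero_le hst))).trans
      (le_of_eq ?_)
    push_cast
    ring

end

/-- The properties of the law `P` of independent Poisson processes on which the construction rests.
The field `joint` says that the past up to time `r` is independent of the increments after `r`, and
that the latter have law `P` again. -/
structure IsGraphicalLaw (c : Edge S → ℝ≥0) (P : Measure (Edge S → CadlagPath ℕ)) : Prop where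
  isProbabilityMeasure : IsProbabilityMeasure P
  mem_Gam : ∀ᵐ K ∂P, K ∈ Gam S
  joint : ∀ r, P.map (fun K => (stopAll r K, incAll r K)) = (P.map (stopAll r)).prod P
  indep : iIndepFun (fun e (K : Edge S → CadlagPath ℕ) => K e) P
  law : ∀ e t, HasLaw (fun K : Edge S → CadlagPath ℕ => (K e).1 t) (poissonMeasure (c e * t)) P

theorem conductance_of_ne (c : Edge S → ℝ≥0) {x y : S} (h : x ≠ y) :
    conductance c x y = c (edge x y h) := by
  classical
  rw [conductance, dif_pos h]

theorem isGraphicalLaw [Countable S] {c : Edge S → ℝ≥0} (hc : ∀ x, rate c x < ∞)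
    {Ω : Type*} [MeasurableSpace Ω] {Q : Measure Ω} [IsProbabilityMeasure Q]
    {N : Edge S → Ω → CadlagPath ℕ} (hN : ∀ e, IsPoissonProcess (c e) (N e) Q)
    (hind : iIndepFun N Q) : IsGraphicalLaw c (Q.map fun ω e => N e ω) := by
  classical
  have hNm : Measurable fun ω e => N e ω := measurable_pi_lambda _ fun e => (hN e).measurable
  have hprob : IsProbabilityMeasure (Q.map fun ω e => N e ω) :=
    Measure.isProbabilityMeasure_map hNm.aemeasurable
  have hprob' : ∀ e, IsProbabilityMeasure (Q.map (N e)) := fun e =>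
    Measure.isProbabilityMeasure_map (hN e).measurable.aemeasurable
  refine ⟨hprob, ?_, fun r => ?_, ?_, fun e t => ?_⟩
  · refine (ae_map_iff hNm.aemeasurable measurableSet_Gam).2 ?_
    have h1 : ∀ᵐ ω ∂Q, ∀ e, HasUnitJumps (N e ω) := ae_all_iff.2 fun e => (hN e).ae_hasUnitJumps
    have h2 : ∀ᵐ ω ∂Q, ∀ e e', e ≠ e' → HasUnitJumps (addPath (N e ω) (N e' ω)) := by
      refine ae_all_iff.2 fun e => ae_all_iff.2 fun e' => ?_
      by_cases he : e = e'
      · exact Eventually.of_forall fun ω h => absurd he h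
      · filter_upwards [(hN e).ae_hasUnitJumps_add (hN e') (hind.indepFun he)] with ω h _
        exact h
    -- by Borel-Cantelli, only finitely many paths at `x` jump before time `T`
    have h3 : ∀ᵐ ω ∂Q, ∀ x, ∀ T : ℕ,
        {y | ∃ h : x ≠ y, (N (edge x y h) ω).1 T ≠ 0}.Finite := by
      refine ae_all_iff.2 fun x => ae_all_iff.2 fun T => ?_
      have hz : ∀ᵐ ω ∂Q, ∀ e, (N e ω).1 0 = 0 := ae_all_iff.2 fun e => (hN e).zero
      have hf := ae_finite_setOfPred_mem (μ := Q)
        (s := fun y => {ω | ∃ h : x ≠ y, (N (edge x y h) ω).1 T - (N (edge x y h) ω).1 0 ≠ 0}) (by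
        have hlt : ∑' y, (conductance c x y : ℝ≥0∞) * (T : ℝ≥0) < ∞ := by
          rw [ENNReal.tsum_mul_right]
          exact ENNReal.mul_lt_top (hc x) ENNReal.coe_lt_top
        refine ((ENNReal.tsum_le_tsum fun y => ?_).trans_lt hlt).ne
        by_cases h : x ≠ y
        · have := (hN (edge x y h)).measure_inc_ne_zero_le (zero_le : (0 : ℝ≥0) ≤ T)
          rw [tsub_zero, ENNReal.coe_mul, ← conductance_of_ne c h] at this
          refine (measure_mono ?_).trans this
          rintro ω ⟨_, hω⟩
          exact hω
        · have : {ω | ∃ h : x ≠ y, (N (edge x y h) ω).1 T - (N (edge x y h) ω).1 0 ≠ 0} = ∅ :=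
            eq_empty_iff_forall_notMem.2 fun ω hω => h hω.choose
          rw [this, measure_empty]
          exact zero_le)
      filter_upwards [hf, hz] with ω hω hz
      refine hω.subset ?_
      rintro y ⟨hy, hy'⟩
      exact ⟨hy, by rw [hz]; exact hy'⟩
    filter_upwards [h1, h2, h3] with ω h1 h2 h3
    exact mem_Gam_iff.2 ⟨h1, fun x T => siteCount_lt_top_of_finite (h3 x T), fun e e' he =>
      (disjoint_jumps_iff (h1 e) (h1 e')).2 (h2 e e' he)⟩
  · have hi : IndepFun (fun ω e => stopPath r (N e ω)) (fun ω e => incPath r (N e ω)) Q :=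
      indepFun_pi_of_iIndepFun hind (fun e => (hN e).measurable) (measurable_stopPath r)
        (measurable_incPath r) fun e => (hN e).indepFun_stop_inc r
    have hs : Measurable fun ω e => stopPath r (N e ω) := (measurable_stopAll r).comp hNm
    have hinc : Measurable fun ω e => incPath r (N e ω) := (measurable_incAll r).comp hNm
    have hj := (indepFun_iff_map_prod_eq_prod_map_map hs.aemeasurable hinc.aemeasurable).1 hi
    have hlaw : Q.map (fun ω e => incPath r (N e ω)) = Q.map fun ω e => N e ω := by
      have hi' : iIndepFun (fun e ω => incPath r (N e ω)) Q :=
        hind.comp (fun _ => incPath r) fun _ => measurable_incPath r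
      rw [hi'.map_fun_eq_infinitePi_map fun e => ((hN e).incPath r).measurable,
        hind.map_fun_eq_infinitePi_map fun e => (hN e).measurable]
      congr with e : 1
      exact ((hN e).incPath r).map_eq (hN e)
    rw [hlaw] at hj
    rw [Measure.map_map ((measurable_stopAll r).prodMk (measurable_incAll r)) hNm,
      Measure.map_map (measurable_stopAll r) hNm]
    exact hj
  · rw [iIndepFun_iff_map_fun_eq_infinitePi_map fun e => measurable_pi_apply e, Measure.map_id',
      hind.map_fun_eq_infinitePi_map fun e => (hN e).measurable]
    congr with e : 1
    rw [Measure.infinitePi_map_eval]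
  · refine ⟨(measurable_eval e t).aemeasurable, ?_⟩
    have h := (hN e).increment 0 t zero_le
    rw [tsub_zero] at h
    rw [← h.map_eq, Measure.map_map (measurable_eval e t) hNm]
    refine Measure.map_congr ?_
    filter_upwards [(hN e).zero] with ω hω
    simp [hω]

end SSEP

namespace SSEP

variable {S : Type*} [Countable S] [MeasurableSpace S] [DiscreteMeasurableSpace S]

/-! ### The number of jumps of the random walk -/

/-- The probability that the sum of the first `n` waiting times of the random walk started at `x` is
at most `r`, given by its first-step recursion. -/
noncomputable def walkProb (c : Edge S → ℝ≥0) : ℕ → S → ℝ≥0∞ → ℝ≥0∞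
  | 0 => fun _ _ => 1
  | n + 1 => fun x r =>
    ∫⁻ w in Iic r, ∫⁻ y, walkProb c n y (r - w) ∂jumpKernel c x ∂waitLaw (rate c x)

theorem walkProb_mono (c : Edge S → ℝ≥0) (n : ℕ) (x : S) : Monotone (walkProb c n x) := by
  induction n generalizing x with
  | zero => exact monotone_const
  | succ n ih =>
    intro r r' h
    refine lintegral_mono' (Measure.restrict_mono (Iic_subset_Iic.2 h) le_rfl) fun w => ?_
    exact lintegral_mono fun y => ih y (tsub_le_tsub_right h w)

/-- The probability that, after the next jump from `x`, the next `n` waiting times sum up to at most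
`r`. -/
noncomputable def jumpProb (c : Edge S → ℝ≥0) (n : ℕ) (x : S) (r : ℝ≥0∞) : ℝ≥0∞ :=
  ∫⁻ y, walkProb c n y r ∂jumpKernel c x

theorem jumpProb_mono (c : Edge S → ℝ≥0) (n : ℕ) (x : S) : Monotone (jumpProb c n x) :=
  fun _ _ h => lintegral_mono fun y => walkProb_mono c n y h

theorem walkProb_succ (c : Edge S → ℝ≥0) (n : ℕ) (x : S) (r : ℝ≥0∞) :
    walkProb c (n + 1) x r = ∫⁻ w in Iic r, jumpProb c n x (r - w) ∂waitLaw (rate c x) :=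
  rfl

/-- For a walk that is about to jump from the site `p.1` at time `p.2`, the probability that this
time is at most `r` and that the next `n` waiting times are over by time `r`. -/
noncomputable def tailProb (c : Edge S → ℝ≥0) (r : ℝ≥0∞) (n : ℕ) (p : S × ℝ≥0∞) : ℝ≥0∞ :=
  (Iic r).indicator (fun s => jumpProb c n p.1 (r - s)) p.2

theorem measurable_tailProb (c : Edge S → ℝ≥0) (r : ℝ≥0∞) (n : ℕ) :
    Measurable (tailProb c r n) := by
  refine measurable_from_prod_countable_right fun y => ?_
  refine Measurable.indicator ?_ measurableSet_Iic
  exact (jumpProb_mono c n y).measurable.comp (measurable_const.sub measurable_id)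

theorem lintegral_arriveKernel (c : Edge S → ℝ≥0) (x : S) {g : S × ℝ≥0∞ → ℝ≥0∞}
    (hg : Measurable g) :
    ∫⁻ p, g p ∂arriveKernel c x = ∫⁻ w, g (x, w) ∂waitLaw (rate c x) := by
  change ∫⁻ p, g p ∂((Measure.dirac x).prod (waitLaw (rate c x))) = _
  rw [Measure.dirac_prod, lintegral_map hg measurable_prodMk_left]

theorem lintegral_tailProb_arriveKernel (c : Edge S → ℝ≥0) (x : S) (r : ℝ≥0∞) (n : ℕ) :
    ∫⁻ p, tailProb c r n p ∂arriveKernel c x = walkProb c (n + 1) x r := by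
  rw [lintegral_arriveKernel c x (measurable_tailProb c r n), walkProb_succ,
    ← lintegral_indicator measurableSet_Iic]
  rfl

theorem lintegral_tailProb_step (c : Edge S → ℝ≥0) {r : ℝ≥0∞} (hr : r ≠ ∞) (n : ℕ) (y : S)
    (s : ℝ≥0∞) :
    ∫⁻ p, tailProb c r n (p.1, s + p.2) ∂(arriveKernel c ∘ₖ jumpKernel c) y =
      tailProb c r (n + 1) (y, s) := by
  have hm : Measurable fun p : S × ℝ≥0∞ => tailProb c r n (p.1, s + p.2) :=
    (measurable_tailProb c r n).comp (measurable_fst.prodMk (measurable_snd.const_add s))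
  rw [Kernel.lintegral_comp _ _ _ hm]
  simp_rw [lintegral_arriveKernel c _ hm]
  by_cases hs : s ≤ r
  · have hs' : s ≠ ∞ := (hs.trans_lt hr.lt_top).ne
    rw [tailProb, indicator_of_mem (show (y, s).2 ∈ Iic r from hs)]
    refine lintegral_congr fun z => ?_
    rw [walkProb_succ, ← lintegral_indicator measurableSet_Iic]
    refine lintegral_congr fun w => ?_
    simp only [tailProb]
    by_cases hw : s + w ≤ r
    · have hw' : w ≤ r - s := ENNReal.le_sub_of_add_le_left hs' hw
      rw [indicator_of_mem (show s + w ∈ Iic r from hw), indicator_of_mem (show w ∈ Iic _ from hw'),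
        tsub_tsub]
    · have hw' : ¬ w ≤ r - s := fun h => hw <| by
        calc s + w ≤ s + (r - s) := by gcongr
          _ = r := add_tsub_cancel_of_le hs
      rw [indicator_of_notMem (show s + w ∉ Iic r from hw),
        indicator_of_notMem (show w ∉ Iic _ from hw')]
  · rw [tailProb, indicator_of_notMem (show (y, s).2 ∉ Iic r from hs)]
    have : ∀ z w, tailProb c r n (z, s + w) = 0 := fun z w =>
      indicator_of_notMem (fun h : s + w ≤ r => hs (le_self_add.trans h)) _
    simp [this]

instance (c : Edge S → ℝ≥0) (x : S) : IsProbabilityMeasure (walkLaw c x) := by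
  unfold walkLaw; infer_instance

/-- The first visited site and its waiting time have the law prescribed by `arriveKernel`. -/
theorem map_walkLaw_zero (c : Edge S → ℝ≥0) (x : S) :
    (walkLaw c x).map (fun ω => ω 0) = arriveKernel c x := by
  have hcomp : (fun ω : ℕ → S × ℝ≥0∞ => ω 0) =
      (fun h : (Π _ : Finset.Iic 0, S × ℝ≥0∞) => h ⟨0, Finset.mem_Iic.2 le_rfl⟩) ∘
        Preorder.frestrictLe (π := fun _ => S × ℝ≥0∞) 0 := rfl
  have hm : Measurable fun h : (Π _ : Finset.Iic 0, S × ℝ≥0∞) =>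
      h ⟨0, Finset.mem_Iic.2 le_rfl⟩ := measurable_pi_apply _
  rw [hcomp, ← Measure.map_map hm (by fun_prop), walkLaw, Kernel.trajMeasure,
    Measure.map_comp _ _ (by fun_prop), Kernel.traj_map_frestrictLe, Kernel.partialTraj_self,
    Measure.id_comp, Measure.map_map hm (by fun_prop)]
  exact Measure.map_id

/-- Markov property of the walk: conditioning on one more site and waiting time trades one of the
remaining waiting times for an observed one. -/
theorem lintegral_walkLaw_succ (c : Edge S → ℝ≥0) (x : S) {r : ℝ≥0∞} (hr : r ≠ ∞) (a n : ℕ) :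
    ∫⁻ ω, tailProb c r n ((ω (a + 1)).1, ∑ i ∈ Finset.Iic (a + 1), (ω i).2) ∂walkLaw c x =
      ∫⁻ ω, tailProb c r (n + 1) ((ω a).1, ∑ i ∈ Finset.Iic a, (ω i).2) ∂walkLaw c x := by
  let G : (Π _ : Finset.Iic a, S × ℝ≥0∞) × (S × ℝ≥0∞) → ℝ≥0∞ := fun q =>
    tailProb c r n (q.2.1, (∑ i, (q.1 i).2) + q.2.2)
  have hsum : Measurable fun h : (Π _ : Finset.Iic a, S × ℝ≥0∞) => ∑ i, (h i).2 :=
    Finset.measurable_fun_sum _ fun i _ => measurable_snd.comp (measurable_pi_apply i)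
  have hG : Measurable G := (measurable_tailProb c r n).comp
    ((measurable_fst.comp measurable_snd).prodMk
      ((hsum.comp measurable_fst).add (measurable_snd.comp measurable_snd)))
  have hs : ∀ ω : ℕ → S × ℝ≥0∞,
      ∑ i, (Preorder.frestrictLe (π := fun _ => S × ℝ≥0∞) a ω i).2 =
        ∑ i ∈ Finset.Iic a, (ω i).2 := fun ω =>
    Finset.sum_coe_sort (Finset.Iic a) fun i => (ω i).2
  have h1 : ∀ ω : ℕ → S × ℝ≥0∞,
      tailProb c r n ((ω (a + 1)).1, ∑ i ∈ Finset.Iic (a + 1), (ω i).2) =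
        G (Preorder.frestrictLe (π := fun _ => S × ℝ≥0∞) a ω, ω (a + 1)) := by
    intro ω
    simp only [G, hs]
    rw [← Nat.range_succ_eq_Iic, Finset.sum_range_succ, Nat.range_succ_eq_Iic]
  have hm : Measurable fun ω : ℕ → S × ℝ≥0∞ =>
      (Preorder.frestrictLe (π := fun _ => S × ℝ≥0∞) a ω, ω (a + 1)) := by fun_prop
  simp_rw [h1]
  rw [← lintegral_map hG hm, walkLaw,
    ← Kernel.map_frestrictLe_trajMeasure_compProd_eq_map_trajMeasure,
    Measure.lintegral_compProd hG, lintegral_map hG.lintegral_kernel_prod_right' (by fun_prop)]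
  refine lintegral_congr fun ω => ?_
  simp only [G, hs]
  exact lintegral_tailProb_step c hr n (ω a).1 _

/-- The first-step recursion `walkProb` does compute the law of the partial sums of waiting times.
-/
theorem walkLaw_sum_le (c : Edge S → ℝ≥0) (x : S) {r : ℝ≥0∞} (hr : r ≠ ∞) (n : ℕ) :
    walkLaw c x {ω | ∑ i ∈ Finset.Iic n, (ω i).2 ≤ r} = walkProb c (n + 1) x r := by
  have key : ∀ a k, ∫⁻ ω, tailProb c r k ((ω a).1, ∑ i ∈ Finset.Iic a, (ω i).2) ∂walkLaw c x =
      walkProb c (a + k + 1) x r := by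
    intro a
    induction a with
    | zero =>
      intro k
      have h0 : ∀ ω : ℕ → S × ℝ≥0∞, ((ω 0).1, ∑ i ∈ Finset.Iic 0, (ω i).2) = ω 0 := fun ω => by
        rw [← Nat.range_succ_eq_Iic]
        simp
      simp_rw [h0]
      rw [← lintegral_map (measurable_tailProb c r k) (measurable_pi_apply 0), map_walkLaw_zero,
        lintegral_tailProb_arriveKernel, zero_add]
    | succ a ih =>
      intro k
      rw [lintegral_walkLaw_succ c x hr, ih (k + 1)]
      congr 1
      ring
  have h1 := key n 0
  rw [add_zero] at h1
  have hm : MeasurableSet {ω : ℕ → S × ℝ≥0∞ | ∑ i ∈ Finset.Iic n, (ω i).2 ≤ r} :=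
    measurableSet_le (Finset.measurable_fun_sum _ fun i _ =>
      measurable_snd.comp (measurable_pi_apply i)) measurable_const
  rw [← h1, ← lintegral_indicator_one hm]
  refine lintegral_congr fun ω => ?_
  simp only [tailProb, indicator, jumpProb, walkProb, lintegral_const, measure_univ, mul_one,
    mem_Iic, Set.mem_ofPred_eq, Pi.one_apply]

/-- Without explosion, the probability of `n` jumps up to time `r` tends to `0` as `n → ∞`. -/
theorem eq_zero_of_forall_le_walkProb {c : Edge S → ℝ≥0} (hc : AssumptionSSEP c) (x : S)
    {r : ℝ≥0∞} (hr : r ≠ ∞) {p : ℝ≥0∞} (hp : ∀ n, p ≤ walkProb c n x r) : p = 0 := by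
  let D : ℕ → Set (ℕ → S × ℝ≥0∞) := fun n => {ω | ∑ i ∈ Finset.Iic n, (ω i).2 ≤ r}
  have hDm : ∀ n, MeasurableSet (D n) := fun n =>
    measurableSet_le (Finset.measurable_fun_sum _ fun i _ =>
      measurable_snd.comp (measurable_pi_apply i)) measurable_const
  have hanti : Antitone D := fun n m hnm ω hω => by
    have h1 : ∑ i ∈ Finset.Iic m, (ω i).2 ≤ r := hω
    exact le_trans (Finset.sum_le_sum_of_subset (f := fun i => (ω i).2)
      (Finset.Iic_subset_Iic.2 hnm)) h1
  have h0 : walkLaw c x (⋂ n, D n) = 0 := by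
    refine measure_eq_zero_iff_ae_notMem.2 ?_
    filter_upwards [hc.no_explosion x] with ω hω hmem
    have : ∑' n, (ω n).2 ≤ r := by
      rw [ENNReal.tsum_eq_iSup_nat]
      refine iSup_le fun n => ?_
      refine le_trans (Finset.sum_le_sum_of_subset ?_) (mem_iInter.1 hmem n)
      intro i hi
      exact Finset.mem_Iic.2 (Finset.mem_range.1 hi).le
    rw [hω] at this
    exact hr (top_le_iff.1 this)
  have ht := tendsto_measure_iInter_atTop (μ := walkLaw c x)
    (fun n => (hDm n).nullMeasurableSet) hanti ⟨0, measure_ne_top _ _⟩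
  rw [h0] at ht
  refine le_antisymm (ge_of_tendsto ht (Eventually.of_forall fun n => ?_)) zero_le
  rw [Function.comp_apply, walkLaw_sum_le c x hr]
  exact hp _

end SSEP

namespace SSEP

variable {S : Type*}

/-! ### Comparison of the backward algorithm with the random walk -/

namespace IsGraphicalLaw

variable {c : Edge S → ℝ≥0} {P : Measure (Edge S → CadlagPath ℕ)}

theorem measure_stop_inter_inc (hP : IsGraphicalLaw c P) (r : ℝ≥0)
    {A E : Set (Edge S → CadlagPath ℕ)} (hA : MeasurableSet A) (hE : MeasurableSet E) :
    P (stopAll r ⁻¹' A ∩ incAll r ⁻¹' E) = P (stopAll r ⁻¹' A) * P E := by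
  have := hP.isProbabilityMeasure
  have h := congrArg (fun μ => μ (A ×ˢ E)) (hP.joint r)
  have h' : P.map (fun K => (stopAll r K, incAll r K)) (A ×ˢ E) =
    ((P.map (stopAll r)).prod P) (A ×ˢ E) := h
  rw [Measure.map_apply ((measurable_stopAll r).prodMk (measurable_incAll r)) (hA.prod hE),
    Measure.prod_prod, Measure.map_apply (measurable_stopAll r) hA] at h'
  exact h'

/-- The probability that the path of `{x, z}` is nonzero at time `s`. -/
theorem measure_ne_zero_le (hP : IsGraphicalLaw c P) (x z : S) (s : ℝ≥0) :
    P {K | ∃ h : x ≠ z, (K (edge x z h)).1 s ≠ 0} ≤ conductance c x z * s := by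
  by_cases h : x ≠ z
  · have h1 : {K : Edge S → CadlagPath ℕ | ∃ h : x ≠ z, (K (edge x z h)).1 s ≠ 0} =
        {K | (K (edge x z h)).1 s ≠ 0} := by
      ext K
      exact ⟨fun ⟨_, h⟩ => h, fun h' => ⟨h, h'⟩⟩
    rw [h1, (hP.law (edge x z h) s).measure_eq (p := fun n => n ≠ 0) MeasurableSet.of_discrete,
      conductance_of_ne c h]
    exact_mod_cast poissonMeasure_ne_zero_le _
  · have h1 : {K : Edge S → CadlagPath ℕ | ∃ h : x ≠ z, (K (edge x z h)).1 s ≠ 0} = ∅ :=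
      eq_empty_iff_forall_notMem.2 fun K hK => h hK.choose
    rw [h1, measure_empty]
    exact zero_le

/-- The probability that no path at `x` has jumped up to time `s`. -/
theorem measure_forall_eq_zero_le (hP : IsGraphicalLaw c P) {x : S} (hx : rate c x ≠ ∞) (s : ℝ≥0) :
    P {K | ∀ y, ∀ h : x ≠ y, (K (edge x y h)).1 s = 0} ≤
      ENNReal.ofReal (Real.exp (-((rate c x).toReal * s))) := by
  classical
  have hsum : HasSum (fun y : {y // x ≠ y} => (c (edge x y.1 y.2) : ℝ)) (rate c x).toReal := by
    have h1 := ENNReal.hasSum_toReal hx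
    have h2 : (rate c x).toReal = ∑' y, ((conductance c x y : ℝ≥0∞)).toReal :=
      ENNReal.tsum_toReal_eq fun _ => ENNReal.coe_ne_top
    rw [← h2] at h1
    refine ((hasSum_subtype_iff_of_support_subset (s := {y | x ≠ y}) ?_).2 h1).congr_fun ?_
    · intro y hy
      by_contra hc
      refine hy ?_
      simp [conductance, show ¬ x ≠ y from hc]
    · rintro ⟨y, hy⟩
      simp [conductance_of_ne c hy]
  have hinj : Function.Injective fun y : {y // x ≠ y} => edge x y.1 y.2 := fun y z h =>
    Subtype.ext (edge_right_injective h)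
  have hind := hP.indep.precomp hinj
  have hlim : Tendsto (fun F : Finset {y // x ≠ y} => ENNReal.ofReal
      (Real.exp (-((∑ y ∈ F, (c (edge x y.1 y.2) : ℝ)) * s)))) atTop
      (𝓝 (ENNReal.ofReal (Real.exp (-((rate c x).toReal * s))))) := by
    refine (ENNReal.continuous_ofReal.tendsto _).comp ((Real.continuous_exp.tendsto _).comp ?_)
    exact (hsum.mul_const (s : ℝ)).neg
  refine ge_of_tendsto hlim (Eventually.of_forall fun F => ?_)
  have hm : ∀ y ∈ F, MeasurableSet[MeasurableSpace.comap
      (fun K : Edge S → CadlagPath ℕ => K (edge x y.1 y.2)) inferInstance]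
      {K : Edge S → CadlagPath ℕ | (K (edge x y.1 y.2)).1 s = 0} := fun y _ =>
    ⟨{f | f.1 s = 0}, measurable_eval_path s (measurableSet_singleton 0), rfl⟩
  have h := hind.meas_biInter hm
  have hsub : {K : Edge S → CadlagPath ℕ | ∀ y, ∀ h : x ≠ y, (K (edge x y h)).1 s = 0} ⊆
      ⋂ y ∈ F, {K | (K (edge x y.1 y.2)).1 s = 0} := fun K hK =>
    mem_iInter₂.2 fun y _ => hK y.1 y.2
  refine (measure_mono hsub).trans (le_of_eq (h.trans ?_))
  rw [Finset.sum_mul, ← Finset.sum_neg_distrib, Real.exp_sum,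
    ENNReal.ofReal_prod_of_nonneg fun _ _ => (Real.exp_pos _).le]
  refine Finset.prod_congr rfl fun y _ => ?_
  have h3 := (hP.law (edge x y.1 y.2) s).measure_eq (p := fun n => n = 0) MeasurableSet.of_discrete
  rw [h3, show {n : ℕ | n = 0} = {0} from rfl, poissonMeasure_singleton]
  simp

variable [Countable S]

/-- The probability of a jump of `{x, z}` in `(a, b]`, without jumps at `x` in `(b, t]`, and of an
event determined by the paths up to time `a`. -/
theorem measure_jumpBetween_inter_le (hP : IsGraphicalLaw c P) {x : S} (hx : rate c x ≠ ∞) (z : S)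
    {a b t : ℝ≥0} (hab : a ≤ b) (hbt : b ≤ t) {A : Set (Edge S → CadlagPath ℕ)}
    (hA : MeasurableSet A) (hAs : ∀ r, a ≤ r → stopAll r ⁻¹' A = A) :
    P ({K | JumpBetween K x z a b t} ∩ A) ≤
      P A * (conductance c x z * (b - a : ℝ≥0)) *
        ENNReal.ofReal (Real.exp (-((rate c x).toReal * (t - b : ℝ≥0)))) := by
  let E : Set (Edge S → CadlagPath ℕ) := {K | ∃ h : x ≠ z, (K (edge x z h)).1 (b - a) ≠ 0}
  let F : Set (Edge S → CadlagPath ℕ) := {K | ∀ y, ∀ h : x ≠ y, (K (edge x y h)).1 (t - b) = 0}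
  let B : Set (Edge S → CadlagPath ℕ) :=
    A ∩ {K | ∃ h : x ≠ z, (K (edge x z h)).1 a < (K (edge x z h)).1 b}
  have hE : MeasurableSet E := by
    simp only [E, ofPred_exists]
    exact MeasurableSet.iUnion fun h => measurable_eval _ _ (measurableSet_singleton 0).compl
  have hF : MeasurableSet F := by
    simp only [F, ofPred_forall]
    exact MeasurableSet.iInter fun y => MeasurableSet.iInter fun h =>
      measurable_eval _ _ (measurableSet_singleton 0)
  have hB : MeasurableSet B := hA.inter (measurableSet_exists_lt x z a b)
  have h1 : {K | JumpBetween K x z a b t} ∩ A ⊆ stopAll b ⁻¹' B ∩ incAll b ⁻¹' F := by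
    rintro K ⟨⟨h1, h2⟩, hKA⟩
    refine ⟨⟨?_, ?_⟩, fun y hy => ?_⟩
    · rw [← hAs b hab] at hKA
      exact hKA
    · obtain ⟨h, h2⟩ := h2
      exact ⟨h, by simpa [stopAll, stopPath, hab] using h2⟩
    · have := h1 y hy
      simp only [incAll, incPath, add_tsub_cancel_of_le hbt]
      omega
  have h2 : stopAll b ⁻¹' B ⊆ stopAll a ⁻¹' A ∩ incAll a ⁻¹' E := by
    rintro K ⟨hKA, h, h2⟩
    refine ⟨?_, h, ?_⟩
    · rw [hAs a le_rfl, ← hAs b hab]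
      exact hKA
    · simp only [stopAll, stopPath, min_self, min_eq_left hab] at h2
      simp only [incAll, incPath, add_tsub_cancel_of_le hab]
      omega
  calc P ({K | JumpBetween K x z a b t} ∩ A) ≤ P (stopAll b ⁻¹' B) * P F :=
        (measure_mono h1).trans (hP.measure_stop_inter_inc b hB hF).le
    _ ≤ (P A * P E) * P F := by
        gcongr
        refine (measure_mono h2).trans (le_of_eq ?_)
        rw [hP.measure_stop_inter_inc a hA hE, hAs a le_rfl]
    _ ≤ _ := by
        gcongr
        · exact hP.measure_ne_zero_le x z _
        · exact hP.measure_forall_eq_zero_le hx _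

end IsGraphicalLaw

section Walk

variable [Countable S] [MeasurableSpace S] [DiscreteMeasurableSpace S]

theorem tsum_conductance_mul (c : Edge S → ℝ≥0) {x : S} (hx : rate c x ≠ ∞) (g : S → ℝ≥0∞) :
    ∑' z, conductance c x z * g z = rate c x * ∫⁻ z, g z ∂jumpKernel c x := by
  by_cases h0 : rate c x = 0
  · have h1 : ∀ z, (conductance c x z : ℝ≥0∞) = 0 := ENNReal.tsum_eq_zero.1 h0
    simp [h0, h1]
  · change _ = rate c x * ∫⁻ z, g z ∂(jumpLaw c x).toMeasure
    rw [lintegral_countable', ← ENNReal.tsum_mul_left]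
    refine tsum_congr fun z => ?_
    have h2 : jumpLaw c x z = conductance c x z * (rate c x)⁻¹ := by
      rw [jumpLaw, dif_pos ⟨h0, hx⟩]
      exact PMF.normalize_apply _ _ _
    rw [PMF.toMeasure_apply_singleton _ _ (measurableSet_singleton z), h2]
    calc _ = (rate c x * (rate c x)⁻¹) * (conductance c x z * g z) := by
          rw [ENNReal.mul_inv_cancel h0 hx, one_mul]
      _ = _ := by ring

theorem le_waitLaw_Ioc (ρ : ℝ≥0∞) (a b : ℝ≥0) :
    ENNReal.ofReal (Real.exp (-(ρ.toReal * a)) - Real.exp (-(ρ.toReal * b))) ≤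
      waitLaw ρ (Ioc (a : ℝ≥0∞) b) := by
  unfold waitLaw
  split_ifs with h
  · simp [h]
  · have hpos : 0 < ρ.toReal := lt_of_le_of_ne ENNReal.toReal_nonneg (Ne.symm h)
    have := isProbabilityMeasure_expMeasure hpos
    rw [Measure.map_apply ENNReal.measurable_ofReal measurableSet_Ioc]
    have hsub : Ioc (a : ℝ) b ⊆ ENNReal.ofReal ⁻¹' Ioc (a : ℝ≥0∞) b := by
      intro u hu
      refine ⟨?_, ?_⟩
      · rw [← ENNReal.ofReal_coe_nnreal]
        exact (ENNReal.ofReal_lt_ofReal_iff_of_nonneg a.2).2 hu.1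
      · rw [← ENNReal.ofReal_coe_nnreal]
        exact ENNReal.ofReal_le_ofReal hu.2
    refine le_trans (le_of_eq ?_) (measure_mono hsub)
    rw [← measure_cdf (expMeasure ρ.toReal), StieltjesFunction.measure_Ioc, cdf_expMeasure_eq hpos,
      cdf_expMeasure_eq hpos, if_pos (NNReal.coe_nonneg a),
      if_pos (NNReal.coe_nonneg b)]
    congr 1
    ring

/-- The rate of a jump in a cell of length `h`, times the probability of no later jump, is up to a
factor `exp (ρ h)` the probability that the waiting time falls into the cell. -/
theorem rate_mul_le_waitLaw {ρ : ℝ≥0∞} (hρ : ρ ≠ ∞) (u h : ℝ≥0) :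
    ρ * h * ENNReal.ofReal (Real.exp (-(ρ.toReal * u))) ≤
      ENNReal.ofReal (Real.exp (ρ.toReal * h)) *
        waitLaw ρ (Ioc (u : ℝ≥0∞) ((u + h : ℝ≥0) : ℝ≥0∞)) := by
  refine le_trans ?_ (mul_le_mul_right (le_waitLaw_Ioc ρ u (u + h)) _)
  have h1 : ρ * h = ENNReal.ofReal (ρ.toReal * h) := by
    rw [ENNReal.ofReal_mul ENNReal.toReal_nonneg, ENNReal.ofReal_toReal hρ,
      ENNReal.ofReal_coe_nnreal]
  rw [h1, ← ENNReal.ofReal_mul (by positivity), ← ENNReal.ofReal_mul (by positivity)]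
  refine ENNReal.ofReal_le_ofReal ?_
  have h2 := Real.add_one_le_exp (ρ.toReal * h)
  have h3 : Real.exp (ρ.toReal * h) * (Real.exp (-(ρ.toReal * u)) -
      Real.exp (-(ρ.toReal * (u + h : ℝ≥0)))) =
      (Real.exp (ρ.toReal * h) - 1) * Real.exp (-(ρ.toReal * u)) := by
    rw [mul_sub, sub_mul, ← Real.exp_add, ← Real.exp_add]
    push_cast
    ring_nf
  rw [h3]
  gcongr
  linarith

/-- The probability that the backward algorithm from `(x, t)` makes `n` moves is at most the
probability that the walk from `x` makes `n` jumps up to time `t`. The induction over `n` compares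
the discretised first move of the algorithm with the first-step recursion of the walk cell by cell.
The factor `exp (ρ h)`, which pays for the discretisation, disappears as the mesh `h` tends to `0`.
-/
theorem IsGraphicalLaw.measure_survive_le {c : Edge S → ℝ≥0}
    {P : Measure (Edge S → CadlagPath ℕ)} (hP : IsGraphicalLaw c P) (hc : ∀ x, rate c x < ∞)
    (n : ℕ) (x : S) (t : ℝ≥0) : P (survive n x t) ≤ walkProb c n x t := by
  have := hP.isProbabilityMeasure
  induction n generalizing x t with
  | zero => exact prob_le_one
  | succ n ih =>
    have hx := (hc x).ne
    set ρ := rate c x with hρ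
    have hD : ∀ m : ℕ, P (stepApprox (survive n) x t m) ≤
        ENNReal.ofReal (Real.exp (ρ.toReal * (t / (m + 1 : ℝ≥0) : ℝ≥0))) *
          walkProb c (n + 1) x t := by
      intro m
      set h : ℝ≥0 := t / (m + 1 : ℝ≥0) with hh
      have hle : ∀ k : ℕ, (k : ℝ≥0) * h ≤ (k + 1 : ℕ) * h := fun k => by gcongr; omega
      have hstep : ∀ k : ℕ, ((k + 1 : ℕ) : ℝ≥0) * h - k * h = h := fun k => by
        rw [← tsub_mul]; simp
      -- a jump in the `k`-th cell, seen backwards from `t`, is a waiting time in `I k`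
      let I : ℕ → Set ℝ≥0∞ := fun k => Ioc (((t - (k + 1 : ℕ) * h : ℝ≥0)) : ℝ≥0∞)
        ((t - k * h : ℝ≥0) : ℝ≥0∞)
      have hI : ∀ k ≤ m, waitLaw ρ (I k) * jumpProb c n x ((k * h : ℝ≥0) : ℝ≥0∞) ≤
          ∫⁻ w in I k, jumpProb c n x (t - w) ∂waitLaw ρ := by
        intro k hk
        rw [mul_comm, ← setLIntegral_const]
        refine setLIntegral_mono' measurableSet_Ioc fun w hw => jumpProb_mono c n x ?_
        have h1 : (k : ℝ≥0) * h ≤ t := (hle k).trans (mesh_le hk)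
        refine ENNReal.le_sub_of_add_le_right (hw.2.trans_lt ENNReal.coe_lt_top).ne ?_
        calc ((k * h : ℝ≥0) : ℝ≥0∞) + w ≤ ((k * h : ℝ≥0) : ℝ≥0∞) + ((t - k * h : ℝ≥0) : ℝ≥0∞) := by
              gcongr; exact hw.2
          _ = t := by rw [← ENNReal.coe_add, add_tsub_cancel_of_le h1]
      have hdisj : ((Finset.range (m + 1) : Finset ℕ) : Set ℕ).PairwiseDisjoint I := by
        have hanti : Antitone fun k : ℕ => ((t - k * h : ℝ≥0) : ℝ≥0∞) := fun k l hkl => by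
          refine ENNReal.coe_le_coe.2 (tsub_le_tsub_left ?_ t)
          gcongr
        exact fun i _ j _ hij => hanti.pairwise_disjoint_on_Ioc_succ hij
      have hcell : ∀ k ≤ m, P (⋃ z, {K | JumpBetween K x z (k * h) ((k + 1 : ℕ) * h) t} ∩
          survive n z (k * h)) ≤ ENNReal.ofReal (Real.exp (ρ.toReal * h)) *
            ∫⁻ w in I k, jumpProb c n x (t - w) ∂waitLaw ρ := by
        intro k hk
        have hu : (t - (k + 1 : ℕ) * h) + h = t - k * h := by
          have h1 := mesh_le (t := t) hk
          rw [← hh] at h1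
          have h2 := hstep k
          have h3 := tsub_add_tsub_cancel h1 (hle k)
          rw [h2] at h3
          exact h3
        calc _ ≤ ∑' z, P ({K | JumpBetween K x z (k * h) ((k + 1 : ℕ) * h) t} ∩
              survive n z (k * h)) := measure_iUnion_le _
          _ ≤ ∑' z, (conductance c x z * walkProb c n z ((k * h : ℝ≥0) : ℝ≥0∞)) *
              (h * ENNReal.ofReal (Real.exp (-(ρ.toReal * (t - (k + 1 : ℕ) * h : ℝ≥0))))) := by
              refine ENNReal.tsum_le_tsum fun z => ?_
              refine (hP.measure_jumpBetween_inter_le hx z (hle k) (mesh_le hk)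
                (measurableSet_survive n z _) fun r hr => ?_).trans ?_
              · ext K
                exact stopAll_mem_survive_iff n z hr
              · rw [hstep]
                calc _ ≤ walkProb c n z ((k * h : ℝ≥0) : ℝ≥0∞) * (conductance c x z * h) *
                      ENNReal.ofReal (Real.exp (-(ρ.toReal * (t - (k + 1 : ℕ) * h : ℝ≥0)))) := by
                      gcongr
                      exact ih z _
                  _ = _ := by ring
          _ = (ρ * h * ENNReal.ofReal (Real.exp (-(ρ.toReal * (t - (k + 1 : ℕ) * h : ℝ≥0))))) *
              jumpProb c n x ((k * h : ℝ≥0) : ℝ≥0∞) := by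
              rw [ENNReal.tsum_mul_right, tsum_conductance_mul c hx, jumpProb]
              ring
          _ ≤ (ENNReal.ofReal (Real.exp (ρ.toReal * h)) * waitLaw ρ (I k)) *
              jumpProb c n x ((k * h : ℝ≥0) : ℝ≥0∞) := by
              refine mul_le_mul' ?_ le_rfl
              have h4 := rate_mul_le_waitLaw hx (t - (k + 1 : ℕ) * h) h
              rw [hu] at h4
              exact h4
          _ ≤ _ := by
              rw [mul_assoc]
              gcongr
              exact hI k hk
      calc P (stepApprox (survive n) x t m)
          ≤ ∑ k ∈ Finset.range (m + 1), P (⋃ z,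
            {K | JumpBetween K x z (k * h) ((k + 1 : ℕ) * h) t} ∩ survive n z (k * h)) :=
            measure_biUnion_finset_le _ _
        _ ≤ ∑ k ∈ Finset.range (m + 1), ENNReal.ofReal (Real.exp (ρ.toReal * h)) *
            ∫⁻ w in I k, jumpProb c n x (t - w) ∂waitLaw ρ :=
            Finset.sum_le_sum fun k hk => hcell k (Nat.lt_succ_iff.1 (Finset.mem_range.1 hk))
        _ = ENNReal.ofReal (Real.exp (ρ.toReal * h)) *
            ∫⁻ w in ⋃ k ∈ Finset.range (m + 1), I k, jumpProb c n x (t - w) ∂waitLaw ρ := by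
            rw [lintegral_biUnion_finset hdisj fun k _ => measurableSet_Ioc, Finset.mul_sum]
        _ ≤ _ := by
            rw [walkProb_succ]
            gcongr
            refine iUnion₂_subset fun k _ w hw => hw.2.trans ?_
            exact ENNReal.coe_le_coe.2 tsub_le_self
    change P (stepSet (survive n) x t) ≤ _
    rw [stepSet_eq]
    refine measure_iUnion_iInter_le hD ?_
    have h1 : Tendsto (fun m : ℕ => ENNReal.ofReal
        (Real.exp (ρ.toReal * (t / (m + 1 : ℝ≥0) : ℝ≥0)))) atTop (𝓝 1) := by
      have h2 := (NNReal.tendsto_coe.2 (tendsto_mesh t)).const_mul ρ.toReal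
      have h3 := (Real.continuous_exp.tendsto _).comp h2
      rw [NNReal.coe_zero, mul_zero, Real.exp_zero] at h3
      simpa [Function.comp_def] using (ENNReal.continuous_ofReal.tendsto _).comp h3
    simpa using ENNReal.Tendsto.mul_const (b := walkProb c (n + 1) x t) h1 (Or.inl one_ne_zero)

/-- Almost surely, the backward algorithm stops from all sites and times. -/
theorem IsGraphicalLaw.ae_mem_GamStar {c : Edge S → ℝ≥0} {P : Measure (Edge S → CadlagPath ℕ)}
    (hP : IsGraphicalLaw c P) (hc : AssumptionSSEP c) : ∀ᵐ K ∂P, K ∈ GamStar S := by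
  have h : ∀ᵐ K ∂P, ∀ x, ∀ q : ℚ≥0, ∃ n, K ∉ survive n x (q : ℝ≥0) := by
    refine ae_all_iff.2 fun x => ae_all_iff.2 fun q => ?_
    have h0 : P (⋂ n, survive n x (q : ℝ≥0)) = 0 :=
      eq_zero_of_forall_le_walkProb hc x (r := ((q : ℝ≥0) : ℝ≥0∞)) ENNReal.coe_ne_top fun n =>
        (measure_mono (iInter_subset _ n)).trans (hP.measure_survive_le hc.rate_lt_top n x q)
    filter_upwards [measure_eq_zero_iff_ae_notMem.1 h0] with K hK
    simpa using hK
  filter_upwards [h, hP.mem_Gam] with K hK hG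
  refine mem_GamStar_of_rat hG fun x q => ?_
  by_contra hc
  obtain ⟨n, hn⟩ := hK x q
  exact hn (mem_survive hG n hc)

end Walk

end SSEP

namespace SSEP

variable {S : Type*}

/-! ### The Markov property -/

theorem etaPath_apply {K : Edge S → CadlagPath ℕ} (hK : K ∈ GamStar S) (σ : S → Bool) (t : ℝ≥0) :
    (etaPath σ K).1 t = eta σ K t := by
  rw [etaPath, dif_pos (isCadlag_eta hK σ)]

theorem eta_zero {K : Edge S → CadlagPath ℕ} (hK : K ∈ Gam S) (σ : S → Bool) :
    eta σ K 0 = σ := by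
  funext x
  have h : Output K x (Iic 0) x := Output.halt x _ <| by
    refine eq_empty_of_forall_notMem fun s hs => ?_
    exact (pos_of_mem_siteJumps hs.2).not_ge hs.1
  rw [eta, (stirX_eq_some_iff hK).2 h, Option.elim_some]

/-- Events in `ℱ_t` depend on the path up to time `t` only. -/
theorem mem_iff_of_measurableSet_pathFiltration {W : Type*} [TopologicalSpace W]
    [MeasurableSpace W] {t : ℝ≥0} {B : Set (CadlagPath W)}
    (hB : MeasurableSet[pathFiltration W t] B) {η η' : CadlagPath W}
    (h : ∀ s ≤ t, η.1 s = η'.1 s) : η ∈ B ↔ η' ∈ B := by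
  have hle : pathFiltration W t ≤
      MeasurableSpace.comap (fun (η : CadlagPath W) (s : Iic t) => η.1 s) MeasurableSpace.pi := by
    refine iSup_le fun s => ?_
    rw [← measurable_iff_comap_le]
    exact (measurable_pi_apply (X := fun _ : Iic t => W) s).comp (comap_measurable _)
  obtain ⟨B', -, rfl⟩ := hle _ hB
  have : (fun s : Iic t => η.1 s) = fun s : Iic t => η'.1 s := funext fun s => h s s.2
  simp only [mem_preimage, this]

theorem measurable_eval_pathFiltration {W : Type*} [TopologicalSpace W] [MeasurableSpace W]
    (t : ℝ≥0) : Measurable[pathFiltration W t] fun η : CadlagPath W => η.1 t :=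
  measurable_iff_comap_le.2 <| le_iSup
    (fun s : Iic t => MeasurableSpace.comap (fun η : CadlagPath W => η.1 s) inferInstance)
    ⟨t, le_refl t⟩

theorem measurable_shiftPath {W : Type*} [TopologicalSpace W] [MeasurableSpace W] (t : ℝ≥0) :
    Measurable (shiftPath (W := W) t) := by
  have h : Measurable fun (η : CadlagPath W) (s : ℝ≥0) => η.1 (t + s) :=
    measurable_pi_lambda _ fun s => (measurable_pi_apply (t + s)).comp measurable_subtype_coe
  exact h.subtype_mk

open Classical in
/-- The path `η^σ_·[𝒦]`, as a function of the pair `(σ, 𝒦)` that is constant in time, equal to `σ`,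
when `𝒦 ∉ Γ_*`. Unlike `etaPath` it is measurable on the whole space. -/
noncomputable def graphPath (p : (S → Bool) × (Edge S → CadlagPath ℕ)) : CadlagPath (S → Bool) :=
  if p.2 ∈ GamStar S then etaPath p.1 p.2 else ⟨fun _ => p.1, isCadlag_const p.1⟩

theorem graphPath_of_mem {σ : S → Bool} {K : Edge S → CadlagPath ℕ} (hK : K ∈ GamStar S) :
    graphPath (σ, K) = etaPath σ K := if_pos hK

theorem graphPath_apply {σ : S → Bool} {K : Edge S → CadlagPath ℕ} (hK : K ∈ GamStar S)
    (t : ℝ≥0) : (graphPath (σ, K)).1 t = eta σ K t := by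
  rw [graphPath_of_mem hK, etaPath_apply hK]

theorem graphPath_stopAll {σ : S → Bool} {K : Edge S → CadlagPath ℕ} (hK : K ∈ GamStar S)
    {r t : ℝ≥0} (ht : t ≤ r) : (graphPath (σ, stopAll r K)).1 t = (graphPath (σ, K)).1 t := by
  rw [graphPath_apply hK, graphPath_apply (stopAll_mem_GamStar hK r), eta_stopAll hK σ ht]

/-- Flow property: the path after time `r` is driven by the increments after `r` only, and starts
from the configuration at time `r`, which is a function of `𝒦` stopped at `r`. -/
theorem shiftPath_graphPath {σ : S → Bool} {K : Edge S → CadlagPath ℕ} (hK : K ∈ GamStar S)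
    (r : ℝ≥0) : shiftPath r (graphPath (σ, K)) =
      graphPath ((graphPath (σ, stopAll r K)).1 r, incAll r K) := by
  refine Subtype.ext (funext fun t => ?_)
  rw [graphPath_apply (incAll_mem_GamStar hK r), graphPath_stopAll hK le_rfl, graphPath_apply hK,
    ← eta_flow hK]
  exact graphPath_apply hK (r + t)

theorem ssepLaw_eq_map {P : Measure (Edge S → CadlagPath ℕ)} (h : ∀ᵐ K ∂P, K ∈ GamStar S)
    (σ : S → Bool) : ssepLaw P σ = P.map fun K => graphPath (σ, K) := by
  rw [ssepLaw, Measure.restrict_eq_self_of_ae_mem h]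
  exact Measure.map_congr (h.mono fun K hK => (graphPath_of_mem hK).symm)

section Measurability

variable [Countable S]

theorem measurable_graphPath : Measurable (graphPath (S := S)) := by
  have hs : MeasurableSet {p : (S → Bool) × (Edge S → CadlagPath ℕ) | p.2 ∈ GamStar S} :=
    measurable_snd measurableSet_GamStar
  refine measurable_of_restrict_of_restrict_compl hs ?_ ?_
  · have h : Measurable fun p : {p : (S → Bool) × (Edge S → CadlagPath ℕ) | p.2 ∈ GamStar S} =>
        ((p.1.1, ⟨p.1.2, p.2⟩) : (S → Bool) × GamStar S) :=
      (measurable_fst.comp measurable_subtype_coe).prodMk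
        ((measurable_snd.comp measurable_subtype_coe).subtype_mk)
    convert measurable_etaPath_prod.comp h using 1
    funext p
    exact if_pos p.2
  · have h : Measurable fun p : ({p : (S → Bool) × (Edge S → CadlagPath ℕ) | p.2 ∈ GamStar S}ᶜ :
        Set _) => (⟨fun _ => p.1.1, isCadlag_const p.1.1⟩ : CadlagPath (S → Bool)) :=
      Measurable.subtype_mk <| measurable_pi_lambda _ fun _ =>
        measurable_fst.comp measurable_subtype_coe
    convert h using 1
    funext p
    exact if_neg p.2

theorem measurable_graphPath_right (σ : S → Bool) :
    Measurable fun K => graphPath (σ, K) := measurable_graphPath.comp measurable_prodMk_left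

theorem measurable_ssepLaw_apply {P : Measure (Edge S → CadlagPath ℕ)} [SFinite P]
    (h : ∀ᵐ K ∂P, K ∈ GamStar S) {A : Set (CadlagPath (S → Bool))} (hA : MeasurableSet A) :
    Measurable fun σ => ssepLaw P σ A := by
  have : (fun σ => ssepLaw P σ A) = fun σ => P (Prod.mk σ ⁻¹' (graphPath ⁻¹' A)) := by
    funext σ
    rw [ssepLaw_eq_map h, Measure.map_apply (measurable_graphPath_right σ) hA]
    rfl
  rw [this]
  exact measurable_measure_prodMk_left (measurable_graphPath hA)

/-- The Markov property at time `t`, integrated over an event `B ∈ ℱ_t`. By the flow property the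
path up to time `t` and the path after time `t` are functions of the stopped paths and of the
increments, whose joint law is a product measure. -/
theorem IsGraphicalLaw.lintegral_ssepLaw {c : Edge S → ℝ≥0}
    {P : Measure (Edge S → CadlagPath ℕ)} (hP : IsGraphicalLaw c P)
    (h : ∀ᵐ K ∂P, K ∈ GamStar S) (σ : S → Bool) (t : ℝ≥0)
    {A B : Set (CadlagPath (S → Bool))} (hA : MeasurableSet A)
    (hB : MeasurableSet[pathFiltration (S → Bool) t] B) :
    ∫⁻ η in B, ssepLaw P (η.1 t) A ∂ssepLaw P σ = ssepLaw P σ (shiftPath t ⁻¹' A ∩ B) := by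
  have := hP.isProbabilityMeasure
  have hB' : MeasurableSet B := (pathFiltration (S → Bool)).le t _ hB
  have hg := measurable_graphPath_right σ
  have hev : Measurable fun K => (graphPath (σ, K)).1 t :=
    (measurable_pi_apply t).comp (measurable_subtype_coe.comp hg)
  have hm : Measurable fun w => ssepLaw P w A := measurable_ssepLaw_apply h hA
  have happ : ∀ w, ssepLaw P w A = P {K | graphPath (w, K) ∈ A} := fun w => by
    rw [ssepLaw_eq_map h, Measure.map_apply (measurable_graphPath_right w) hA]
    rfl
  have hmem : ∀ K ∈ GamStar S, graphPath (σ, stopAll t K) ∈ B ↔ graphPath (σ, K) ∈ B :=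
    fun K hK => mem_iff_of_measurableSet_pathFiltration hB fun s hs => graphPath_stopAll hK hs
  set R : Set ((Edge S → CadlagPath ℕ) × (Edge S → CadlagPath ℕ)) :=
    {p | graphPath (σ, p.1) ∈ B ∧ graphPath ((graphPath (σ, p.1)).1 t, p.2) ∈ A} with hR
  have hRm : MeasurableSet R := by
    refine MeasurableSet.inter ((hg.comp measurable_fst) hB') ?_
    exact (measurable_graphPath.comp ((hev.comp measurable_fst).prodMk measurable_snd)) hA
  set C := (fun K => graphPath (σ, K)) ⁻¹' B with hC
  have hsec : ∀ K, P (Prod.mk K ⁻¹' R) =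
      C.indicator
        (fun K => ssepLaw P ((graphPath (σ, K)).1 t) A) K := fun K => by
    by_cases hK : graphPath (σ, K) ∈ B
    · have hK' : K ∈ C := hK
      rw [indicator_of_mem hK', happ]
      congr 1
      ext K'
      simp [hR, hK]
    · have hK' : K ∉ C := hK
      rw [indicator_of_notMem hK']
      have : Prod.mk K ⁻¹' R = ∅ := by
        ext K'
        simp [hR, hK]
      rw [this, measure_empty]
  have hind : Measurable (C.indicator
      fun K => ssepLaw P ((graphPath (σ, K)).1 t) A) := (hm.comp hev).indicator (hg hB')
  calc ∫⁻ η in B, ssepLaw P (η.1 t) A ∂ssepLaw P σ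
      = ∫⁻ K, C.indicator
          (fun K => ssepLaw P ((graphPath (σ, K)).1 t) A) K ∂P := by
        have hm' : Measurable fun η : CadlagPath (S → Bool) => ssepLaw P (η.1 t) A :=
          hm.comp ((measurable_pi_apply t).comp measurable_subtype_coe)
        rw [ssepLaw_eq_map h σ, setLIntegral_map hB' hm' hg, lintegral_indicator (hg hB')]
    _ = ∫⁻ K, C.indicator
          (fun K => ssepLaw P ((graphPath (σ, K)).1 t) A) (stopAll t K) ∂P := by
        refine lintegral_congr_ae (h.mono fun K hK => ?_)
        have hKC : stopAll t K ∈ C ↔ K ∈ C := hmem K hK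
        beta_reduce
        by_cases hK' : K ∈ C
        · rw [indicator_of_mem hK', indicator_of_mem (hKC.2 hK'), graphPath_stopAll hK le_rfl]
        · rw [indicator_of_notMem hK', indicator_of_notMem (mt hKC.1 hK')]
    _ = ((P.map (stopAll t)).prod P) R := by
        rw [Measure.prod_apply hRm, ← lintegral_map hind (measurable_stopAll t)]
        exact lintegral_congr fun K => (hsec K).symm
    _ = P {K | (stopAll t K, incAll t K) ∈ R} := by
        rw [← hP.joint t,
          Measure.map_apply ((measurable_stopAll t).prodMk (measurable_incAll t)) hRm]
        rfl
    _ = ssepLaw P σ (shiftPath t ⁻¹' A ∩ B) := by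
        rw [ssepLaw_eq_map h σ, Measure.map_apply hg ((measurable_shiftPath t hA).inter hB')]
        refine measure_congr (h.mono fun K hK => propext ?_)
        change (_ ∧ _) ↔ (_ ∈ A ∧ _)
        rw [hmem K hK, shiftPath_graphPath hK, and_comm]

/-- The laws of the paths given by the graphical construction form a Markov process. -/
theorem IsGraphicalLaw.isMarkovProcess {c : Edge S → ℝ≥0}
    {P : Measure (Edge S → CadlagPath ℕ)} (hP : IsGraphicalLaw c P)
    (h : ∀ᵐ K ∂P, K ∈ GamStar S) : IsMarkovProcess (ssepLaw P) := by
  have := hP.isProbabilityMeasure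
  have hprob : ∀ σ, IsProbabilityMeasure (ssepLaw P σ) := fun σ => by
    rw [ssepLaw_eq_map h]
    exact Measure.isProbabilityMeasure_map (measurable_graphPath_right σ).aemeasurable
  refine ⟨hprob, fun σ => ?_, fun A hA => measurable_ssepLaw_apply h hA, fun σ t A hA => ?_⟩
  · have hs : MeasurableSet {η : CadlagPath (S → Bool) | η.1 0 = σ} := by
      have h0 : Measurable fun η : CadlagPath (S → Bool) => η.1 0 :=
        (measurable_pi_apply 0).comp measurable_subtype_coe
      exact h0 (measurableSet_singleton σ)
    rw [ssepLaw_eq_map h, Measure.map_apply (measurable_graphPath_right σ) hs]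
    refine (prob_compl_eq_zero_iff (measurable_graphPath_right σ hs)).1 ?_
    refine ae_iff.1 (h.mono fun K hK => ?_)
    change (graphPath (σ, K)).1 0 = σ
    rw [graphPath_apply hK, eta_zero (mem_GamStar_iff.1 hK).1]
  · have hA' := measurable_shiftPath t hA
    have hm : Measurable fun w => ssepLaw P w A := measurable_ssepLaw_apply h hA
    have hmt : Measurable[pathFiltration (S → Bool) t]
        fun η : CadlagPath (S → Bool) => ssepLaw P (η.1 t) A :=
      hm.comp (measurable_eval_pathFiltration t)
    have hle := (pathFiltration (S → Bool)).le t
    have hreal : StronglyMeasurable[pathFiltration (S → Bool) t]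
        fun η : CadlagPath (S → Bool) => (ssepLaw P (η.1 t)).real A :=
      hmt.ennreal_toReal.stronglyMeasurable
    have hint : Integrable (fun η : CadlagPath (S → Bool) => (ssepLaw P (η.1 t)).real A)
        (ssepLaw P σ) :=
      Integrable.of_bound (hreal.mono hle).aestronglyMeasurable 1 <| ae_of_all _ fun η => by
        rw [Real.norm_of_nonneg measureReal_nonneg]
        exact measureReal_le_one
    refine (ae_eq_condExp_of_forall_setIntegral_eq hle
      ((integrable_const (1 : ℝ)).indicator hA') (fun B _ _ => hint.integrableOn)
      (fun B hB _ => ?_) hreal.aestronglyMeasurable).symm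
    rw [integral_indicator hA', setIntegral_const, smul_eq_mul, mul_one,
      measureReal_restrict_apply hA']
    have hfin : ∀ᵐ η ∂(ssepLaw P σ).restrict B, ssepLaw P (η.1 t) A < ∞ :=
      ae_of_all _ fun η => measure_lt_top _ _
    rw [measureReal_def, ← hP.lintegral_ssepLaw h σ t hA hB]
    exact integral_toReal (hmt.mono hle le_rfl).aemeasurable hfin

end Measurability

end SSEP

/-- Construction of the symmetric simple exclusion process. Here `N` is a family of independent
Poisson processes `N_{x,y}` of intensity `c_{x,y}` indexed by the unordered pairs, `P` is its law on
`D(ℝ₊, ℕ)^{ℰ_S}`, and `SSEP.ssepLaw P σ` is the law of the path given by the graphical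
construction. -/
theorem proposition3p1 {S : Type*} [Countable S] [MeasurableSpace S] [DiscreteMeasurableSpace S]
    (c : SSEP.Edge S → ℝ≥0) (hc : SSEP.AssumptionSSEP c)
    {Ω : Type*} [MeasurableSpace Ω] (Q : Measure Ω) [IsProbabilityMeasure Q]
    (N : SSEP.Edge S → Ω → SSEP.CadlagPath ℕ)
    (hN : ∀ e, SSEP.IsPoissonProcess (c e) (N e) Q) (hind : iIndepFun N Q)
    (P : Measure (SSEP.Edge S → SSEP.CadlagPath ℕ)) (hP : P = Q.map fun ω e => N e ω) :
    -- the construction is a.s. well posed and yields càdlàg paths, measurably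
    (MeasurableSet (SSEP.GamStar S) ∧ P (SSEP.GamStar S) = 1 ∧
      (∀ K ∈ SSEP.GamStar S, ∀ x t, ∃! y, SSEP.Output K x (Iic t) y) ∧
      (∀ σ : S → Bool, ∀ K ∈ SSEP.GamStar S, SSEP.IsCadlag (SSEP.eta σ K)) ∧
      (∀ σ : S → Bool, Measurable fun K : SSEP.GamStar S => SSEP.etaPath σ K.1)) ∧
    -- the laws form a Markov process
    SSEP.IsMarkovProcess (SSEP.ssepLaw P) := by
  subst hP
  have hG := SSEP.isGraphicalLaw hc.rate_lt_top hN hind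
  have hae := hG.ae_mem_GamStar hc
  have := hG.isProbabilityMeasure
  refine ⟨⟨SSEP.measurableSet_GamStar, ?_, fun K hK x t => ?_,
    fun σ K hK => SSEP.isCadlag_eta hK σ, fun σ => ?_⟩, hG.isMarkovProcess hae⟩
  · exact (prob_compl_eq_zero_iff SSEP.measurableSet_GamStar).1 (ae_iff.1 hae)
  · obtain ⟨hK', hx⟩ := SSEP.mem_GamStar_iff.1 hK
    obtain ⟨y, hy⟩ := hx x t
    exact ⟨y, hy, fun z hz => hz.unique hK' hy⟩
  · exact SSEP.measurable_etaPath_prod.comp measurable_prodMk_left
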